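/- Let $\Lambda_0,\Lambda_1,\Gamma$ be countable groups and let $K$ be a compact second countable (Hausdorff) group. For $i=0,1$ let $(X_i,\mu_i)$ be a standard probability space with an essentially free p.m.p. action $\Lambda_i\times K\curvearrowright (X_i,\mu_i)$, i.e. an action such that $(g,x)\mapsto g\cdot x$ is Borel, every $g$ preserves $\mu_i$, and a.e. $x\in X_i$ has trivial stabilizer in $\Lambda_i\times K$. Let $G_i=\Gamma*\Lambda_i$ be the free product, with $\Lambda_i<G_i$. Choose a map $r_i:G_i\to\Lambda_i$ with $r_i(\lambda g)=\lambda r_i(g)$ for all $\lambda\in\Lambda_i$, $g\in G_i$, and $r_i(e)=e$. Let $Y_i=X_i^{\Lambda_i\backslash G_i}$ with the product measure. Consider the co-induced action $G_i\curvearrowright Y_i$ of $\Lambda_i\curvearrowright X_i$, $$(g\cdot y)_{\Lambda_i k}=\bigl(r_i(k)^{-1}r_i(kg)\bigr)\cdot y_{\Lambda_i kg}\qquad (g,k\in G_i,\ y\in Y_i),$$ and the diagonal action of $K$ on $Y_i$, which commutes with it. Denote by $X_i/K$ and $Y_i/K$ the spaces of $K$-orbits, with the quotient $\sigma$-algebra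 and the image measure, and with the induced actions $\Lambda_i\curvearrowright X_i/K$ and $G_i\curvearrowright Y_i/K$. An isomorphism of probability spaces is a measure preserving Borel bijection between conegligible subsets. Two actions $G\curvearrowright Z$ and $H\curvearrowright W$ on probability spaces are orbit equivalent if there is an isomorphism of probability spaces $\Delta:Z\to W$ with $\Delta(G\cdot z)=H\cdot\Delta(z)$ for a.e. $z\in Z$. They are conjugate with respect to a group isomorphism $\delta:G\to H$ if there is an isomorphism of probability spaces $\Delta:Z\to W$ with $\Delta(g\cdot z)=\delta(g)\cdot\Delta(z)$ for all $g\in G$ and a.e. $z\in Z$. Then the following hold. 1. If the actions $\Lambda_i\curvearrowright X_i/K$ ($i=0,1$) are orbit equivalent, then the actions $G_i\curvearrowright Y_i/K$ ($i=0,1$) are orbit equivalent. 2. If the actions $\Lambda_i\curvearrowright X_i/K$ ($i=0,1$) are conjugate with respect to a group isomorphism $\delta:\Lambda_0\to\Lambda_1$, then the actions $G_i\curvearrowright Y_i/K$ ($i=0,1$) are conjugate with respect to the group isomorphism $\mathrm{id}*\delta:G_0\to G_1$. -/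

import Mathlib

open MeasureTheory

namespace CoInd

/-! ### Actions, isomorphisms of probability spaces, orbit equivalence and conjugacy -/

section Actions

/-- A p.m.p. action of `G` on `(X, μ)`: an action `α` of the group `G` on the set `X` such that
`(g, x) ↦ g · x` is measurable and every `g` preserves `μ`. -/
structure IsPMP {G X : Type*} [Group G] [MeasurableSpace G] [MeasurableSpace X]
    (α : G →* Equiv.Perm X) (μ : Measure X) : Prop where
  measurable : Measurable fun p : G × X => α p.1 p.2
  measurePreserving : ∀ g : G, MeasurePreserving (fun x => α g x) μ μ

/-- Essential freeness: almost every point has a trivial stabilizer. -/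
def IsEssentiallyFree {G X : Type*} [Group G] [MeasurableSpace X]
    (α : G →* Equiv.Perm X) (μ : Measure X) : Prop :=
  ∀ᵐ x ∂μ, ∀ g : G, α g x = x → g = 1

/-- The orbit of `x` under the action `α`. -/
def orbit {G X : Type*} [Group G] (α : G →* Equiv.Perm X) (x : X) : Set X :=
  Set.range fun g : G => α g x

/-- An isomorphism of probability spaces: a measure preserving bijection, measurable in both
directions, between conegligible measurable subsets `source ⊆ X` and `target ⊆ Y`.
(The values of the underlying functions outside `source` and `target` are irrelevant.) -/
structure ProbIso {X Y : Type*} [MeasurableSpace X] [MeasurableSpace Y]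
    (μ : Measure X) (ν : Measure Y) extends PartialEquiv X Y where
  measurableSet_source : MeasurableSet source
  measurableSet_target : MeasurableSet target
  ae_mem_source : ∀ᵐ x ∂μ, x ∈ source
  ae_mem_target : ∀ᵐ y ∂ν, y ∈ target
  measurable_toFun : Measurable fun x : source => toFun x
  measurable_invFun : Measurable fun y : target => invFun y
  measure_preimage : ∀ s : Set Y, MeasurableSet s → μ (source ∩ toFun ⁻¹' s) = ν s

/-- Orbit equivalence: there is an isomorphism of probability spaces `Δ` with
`Δ (G · x) = H · Δ x` for a.e. `x`. -/
def OrbitEquivalent {G H X Y : Type*} [Group G] [Group H] [MeasurableSpace X] [MeasurableSpace Y]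
    (α : G →* Equiv.Perm X) (μ : Measure X) (β : H →* Equiv.Perm Y) (ν : Measure Y) : Prop :=
  ∃ Δ : ProbIso μ ν, ∀ᵐ x ∂μ, Δ.toFun '' orbit α x = orbit β (Δ.toFun x)

/-- Conjugacy with respect to the group isomorphism `δ`: there is an isomorphism of probability
spaces `Δ` with `Δ (g · x) = δ g · Δ x` for all `g` and a.e. `x`. -/
def ConjugateVia {G H X Y : Type*} [Group G] [Group H] [MeasurableSpace X] [MeasurableSpace Y]
    (δ : G ≃* H) (α : G →* Equiv.Perm X) (μ : Measure X)
    (β : H →* Equiv.Perm Y) (ν : Measure Y) : Prop :=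
  ∃ Δ : ProbIso μ ν, ∀ g : G, ∀ᵐ x ∂μ, Δ.toFun (α g x) = β (δ g) (Δ.toFun x)

end Actions

/-! ### The quotient by `K` of an action of `H × K` -/

section Quotients

variable {H K X : Type*} [Group H] [Group K]

/-- The equivalence relation on `X` whose classes are the `K`-orbits. -/
def orbitSetoid (α : H × K →* Equiv.Perm X) : Setoid X where
  r x y := ∃ k : K, α (1, k) x = y
  iseqv :=
    { refl := fun x => ⟨1, by rw [← Prod.one_eq_mk, map_one]; rfl⟩
      symm := by
        rintro x y ⟨k, rfl⟩
        refine ⟨k⁻¹, ?_⟩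
        rw [← Equiv.Perm.mul_apply, ← map_mul, Prod.mk_mul_mk, inv_mul_cancel, mul_one,
          ← Prod.one_eq_mk, map_one]
        rfl
      trans := by
        rintro x y z ⟨k, rfl⟩ ⟨l, rfl⟩
        refine ⟨l * k, ?_⟩
        rw [← Equiv.Perm.mul_apply, ← map_mul, Prod.mk_mul_mk, mul_one] }

/-- The space `X / K` of `K`-orbits (with the quotient σ-algebra). -/
abbrev OrbitSpace (α : H × K →* Equiv.Perm X) : Type _ := Quotient (orbitSetoid α)

/-- The quotient measure on `X / K`: the image of `μ` under the factor map. -/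
noncomputable def quotientMeasure [MeasurableSpace X] (α : H × K →* Equiv.Perm X)
    (μ : Measure X) : Measure (OrbitSpace α) :=
  μ.map (Quotient.mk (orbitSetoid α))

/-- The map of `X / K` induced by `h : H`, that is, `K · x ↦ K · (h · x)`. -/
def quotientMap (α : H × K →* Equiv.Perm X) (h : H) : OrbitSpace α → OrbitSpace α :=
  Quotient.map (fun x => α (h, 1) x) (by
    rintro x y ⟨k, rfl⟩
    refine ⟨k, ?_⟩
    simp only [← Equiv.Perm.mul_apply, ← map_mul, Prod.mk_mul_mk, mul_one, one_mul])

/-- The factor action of `H` on `X / K`, given by `h · (K · x) = K · (h · x)`. -/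
def quotientAction (α : H × K →* Equiv.Perm X) : H →* Equiv.Perm (OrbitSpace α) :=
  letI : MulAction H (OrbitSpace α) :=
    { smul := quotientMap α
      one_smul := by
        rintro ⟨x⟩
        change (Quotient.mk (orbitSetoid α) (α (1, 1) x)) = Quotient.mk _ x
        rw [← Prod.one_eq_mk, map_one]
        rfl
      mul_smul := by
        rintro g h ⟨x⟩
        change (Quotient.mk (orbitSetoid α) (α (g * h, 1) x)) =
          Quotient.mk _ (α (g, 1) (α (h, 1) x))
        rw [← Equiv.Perm.mul_apply, ← map_mul, Prod.mk_mul_mk, mul_one] }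
  MulAction.toPermHom H (OrbitSpace α)

end Quotients

/-! ### Co-induction along an embedding `ι : Λ → G` -/

section CoInduction

variable {Λ G K X : Type*} [Group Λ] [Group G] [Group K]

/-- The space `Λ \ G` of right cosets `Λ g`. -/
abbrev RightCosets (ι : Λ →* G) : Type _ := Quotient (QuotientGroup.rightRel ι.range)

/-- The coset `Λ g`. -/
def coset (ι : Λ →* G) (g : G) : RightCosets ι := Quotient.mk _ g

/-- A choice of a map `r : G → Λ` with `r (λ g) = λ r(g)` and `r e = e`. (Such a map exists exactly
when `ι` is injective.) -/
structure EquivariantMap (ι : Λ →* G) where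
  toFun : G → Λ
  map_mul : ∀ (l : Λ) (g : G), toFun (ι l * g) = l * toFun g
  map_one : toFun 1 = 1

/-- The right translation action of `G` on `Λ \ G`, given by `(Λ k) g = Λ k g`. -/
def cosetMul (ι : Λ →* G) (c : RightCosets ι) (g : G) : RightCosets ι :=
  Quotient.map (fun k => k * g) (by
    intro a b hab
    change QuotientGroup.rightRel ι.range a b at hab
    change QuotientGroup.rightRel ι.range (a * g) (b * g)
    rw [QuotientGroup.rightRel_apply] at hab ⊢
    simpa [mul_assoc] using hab) c

/-- The cocycle `Ω (Λ k, g) = r(k)⁻¹ r(k g)`. -/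
def Omega {ι : Λ →* G} (r : EquivariantMap ι) (c : RightCosets ι) (g : G) : Λ :=
  Quotient.lift (fun k => (r.toFun k)⁻¹ * r.toFun (k * g)) (by
    intro a b hab
    change QuotientGroup.rightRel ι.range a b at hab
    rw [QuotientGroup.rightRel_apply] at hab
    obtain ⟨l, hl⟩ := hab
    have hb : b = ι l * a := by rw [hl]; group
    subst hb
    simp only [mul_assoc, r.map_mul, mul_inv_rev, inv_mul_cancel_left]) c

/-- The co-induced action of `Λ ↷ X` to `G`: the action of `G` on `X ^ (Λ \ G)` given by
`(g · y)_{Λ k} = Ω (Λ k, g) · y_{Λ k g}`. -/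
def coinducedAction {ι : Λ →* G} (r : EquivariantMap ι) (α : Λ →* Equiv.Perm X) :
    G →* Equiv.Perm (RightCosets ι → X) :=
  letI : MulAction G (RightCosets ι → X) :=
    { smul := fun g y c => α (Omega r c g) (y (cosetMul ι c g))
      one_smul := by
        intro y
        funext c
        induction c using Quotient.inductionOn with
        | h k =>
          change α ((r.toFun k)⁻¹ * r.toFun (k * 1)) (y (coset ι (k * 1))) = y (coset ι k)
          simp
      mul_smul := by
        intro g h y
        funext c
        induction c using Quotient.inductionOn with
        | h k =>
          change α ((r.toFun k)⁻¹ * r.toFun (k * (g * h))) (y (coset ι (k * (g * h)))) =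
            α ((r.toFun k)⁻¹ * r.toFun (k * g))
              (α ((r.toFun (k * g))⁻¹ * r.toFun (k * g * h)) (y (coset ι (k * g * h))))
          rw [← Equiv.Perm.mul_apply, ← _root_.map_mul]
          simp [mul_assoc] }
  MulAction.toPermHom G (RightCosets ι → X)

/-- The diagonal action of `K` on `X ^ I`. -/
def diagonalAction (I : Type*) (β : K →* Equiv.Perm X) : K →* Equiv.Perm (I → X) :=
  letI : MulAction K (I → X) :=
    { smul := fun k y i => β k (y i)
      one_smul := by
        intro y
        funext i
        change β 1 (y i) = y i
        simp
      mul_smul := by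
        intro k l y
        funext i
        change β (k * l) (y i) = β k (β l (y i))
        simp }
  MulAction.toPermHom K (I → X)

/-- For an action of `Λ × K` on `X`, the action of `G × K` on `Y = X ^ (Λ \ G)` made up of the
co-induced action to `G` of `Λ ↷ X` and the diagonal action of `K`, which commute. -/
def coinducedProdAction {ι : Λ →* G} (r : EquivariantMap ι) (α : Λ × K →* Equiv.Perm X) :
    G × K →* Equiv.Perm (RightCosets ι → X) :=
  (coinducedAction r (α.comp (MonoidHom.inl Λ K))).noncommCoprod
    (diagonalAction (RightCosets ι) (α.comp (MonoidHom.inr Λ K))) (by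
      intro g k
      ext y c
      change α (Omega r c g, 1) (α (1, k) (y (cosetMul ι c g))) =
        α (1, k) (α (Omega r c g, 1) (y (cosetMul ι c g)))
      simp only [← Equiv.Perm.mul_apply, ← _root_.map_mul, Prod.mk_mul_mk, mul_one, one_mul])

/-- The product probability measure on `Y = X ^ (Λ \ G)`. -/
noncomputable def coinducedMeasure [MeasurableSpace X] (ι : Λ →* G) (μ : Measure X)
    [IsProbabilityMeasure μ] : Measure (RightCosets ι → X) :=
  Measure.infinitePi fun _ => μ

/-- The embedding of `Λ` as the second factor of the free product `Γ * Λ`. -/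
def freeFactor (Γ Λ : Type*) [Group Γ] [Group Λ] : Λ →* Monoid.Coprod Γ Λ :=
  Monoid.Coprod.inr

end CoInduction

end CoInd

/-!
Both parts follow from one construction. Since `K` is compact and acts essentially freely, each
`X_i → X_i / K` has a measurable section, and an isomorphism of the spaces of `K`-orbits lifts to a
`K`-equivariant one between invariant conull sets. After null sets are discarded, two free actions
of `Λ₀ × K` and `Λ₁ × K` on one space `X` remain, which agree on `K` and have the same orbits
(`CoInd.exists_common_model`, `CoInd.SameOrbits`); from there on everything holds pointwise.

A space `W` with an action of `(Γ * Λ₀) × K` and a `Λ₀ × K`-equivariant map `p : W → X` can be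
rewired into a space with an action of `(Γ * Λ₁) × K` over the same `p`: the group `Γ` acts as before
and `l ∈ Λ₁` moves `w` by the element of `Λ₀ × K` that moves `p w` as `l` does
(`CoInd.SameOrbits.rewire`). Rewiring keeps the orbits, is functorial, and rewiring back is the
identity. The co-induced space, with the evaluation at the trivial coset, is the terminal object
among such spaces `W`, so rewiring turns the terminal object for `Λ₀` into the one for `Λ₁`. This
gives a bijection `CoInd.SameOrbits.theta` between the co-induced spaces that respects `K` and the
orbits, and it intertwines the actions along `id * δ` up to `K` if `Λ₀` and `Λ₁` move the points of
`X` alike up to `δ` and `K`.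

It remains to see that `theta` preserves the product measures. The output at a coset `Λ₁ g` reads
one coordinate of the input `y` and moves it by an element of `Λ₀ × K` and one of `Λ₁`; the
coordinate and the elements are determined by the coordinates read at the shorter cosets along a
word for `g`. Distinct outputs read distinct coordinates
(`CoInd.SameOrbits.coset_eq_of_coset_label_eq`): the label of `g`, the element of `(Γ * Λ₀) × K`
that moves `y` as `g` does, is itself obtained by rewiring the regular action over the orbit of
`y`, hence is injective in `g`. Conditionally on all outputs that are not longer, an output thus has
the law `μ`, and the outputs are independent (`CoInd.measurePreserving_of_adaptive`).

The measurable sections come from a countable family of functions, obtained by averaging over `K`,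
that separates points and is continuous along `K`-orbits: every orbit has a unique lexicographically
minimal point (`CoInd.exists_measurable_equivariant_of_free`).
-/

namespace CoInd

/-! ### Compact group actions on standard Borel spaces -/

/-- The inverse of the normalised (left) Haar measure. -/
theorem exists_rightInvariant_probabilityMeasure (K : Type*) [Group K] [TopologicalSpace K]
    [IsTopologicalGroup K] [CompactSpace K] [SecondCountableTopology K]
    [MeasurableSpace K] [BorelSpace K] :
    ∃ m : Measure K, IsProbabilityMeasure m ∧ m.IsMulRightInvariant := by
  let m₀ : Measure K := Measure.haarMeasure ⊤
  have h₀ : IsProbabilityMeasure m₀ := ⟨Measure.haarMeasure_self (K₀ := ⊤)⟩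
  refine ⟨m₀.inv, ⟨?_⟩, inferInstance⟩
  rw [Measure.inv_apply]
  simp

theorem polishSpace_of_compact (K : Type*) [TopologicalSpace K] [T2Space K] [CompactSpace K]
    [SecondCountableTopology K] : PolishSpace K := by
  let _ := TopologicalSpace.metrizableSpaceMetric K
  infer_instance

/-- The functions are `x ↦ ∫ φ k * f (k • x) dk` for a bounded injective Borel function `f` and a
dense sequence of continuous `φ`. They determine `k ↦ f (k • x)` almost everywhere, and hence `x`,
because `f (k • x) = f (k • y)` for a single `k` already forces `x = y`. -/
theorem exists_separating_continuous_on_orbits {K X : Type*} [Group K] [TopologicalSpace K]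
    [IsTopologicalGroup K] [T2Space K] [CompactSpace K] [SecondCountableTopology K] [MeasurableSpace K] [BorelSpace K]
    [MeasurableSpace X] [StandardBorelSpace X]
    (β : K →* Equiv.Perm X) (hβ : Measurable fun p : K × X => β p.1 p.2) :
    ∃ h : ℕ → X → ℝ, (∀ n, Measurable (h n)) ∧ (∀ n x, Continuous fun k => h n (β k x)) ∧
      ∀ x y, (∀ n, h n x = h n y) → x = y := by
  obtain ⟨m, hm, hminv⟩ := exists_rightInvariant_probabilityMeasure K
  have := polishSpace_of_compact K
  set f : X → ℝ := fun x => Real.arctan (embeddingReal X x) + 2 with hf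
  have hfm : Measurable f := (Real.measurable_arctan.comp (measurable_embeddingReal X)).add_const 2
  have hfi : Function.Injective f := by
    intro x y hxy
    exact (measurableEmbedding_embeddingReal X).injective
      (Real.arctan_injective (add_right_cancel hxy))
  have hf0 : ∀ x, 0 ≤ f x := fun x => by
    have := Real.neg_pi_div_two_lt_arctan (embeddingReal X x)
    have := Real.pi_lt_four
    simp only [hf]; linarith
  have hf4 : ∀ x, ‖f x‖ ≤ 4 := fun x => by
    have := Real.arctan_lt_pi_div_two (embeddingReal X x)
    have := Real.pi_lt_four
    rw [Real.norm_of_nonneg (hf0 x)]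
    simp only [hf]; linarith
  have hF : ∀ x, Measurable fun k => f (β k x) := fun x =>
    hfm.comp (hβ.comp (measurable_id.prodMk measurable_const))
  let I : C(K, ℝ) → X → ℝ := fun φ x => ∫ k, φ k * f (β k x) ∂m
  have hint : ∀ (φ : C(K, ℝ)) (x : X), Integrable (fun k => φ k * f (β k x)) m := by
    intro φ x
    refine Integrable.of_bound (C := ‖φ‖ * 4)
      (φ.continuous.measurable.mul (hF x)).aestronglyMeasurable (ae_of_all _ fun k => ?_)
    rw [norm_mul]
    exact mul_le_mul (φ.norm_coe_le_norm k) (hf4 _) (norm_nonneg _) (norm_nonneg _)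
  have hcont : ∀ x, Continuous fun φ => I φ x := by
    intro x
    refine (LipschitzWith.of_dist_le_mul (K := 4) fun φ ψ => ?_).continuous
    rw [dist_eq_norm, dist_eq_norm, ← integral_sub (hint φ x) (hint ψ x)]
    refine (norm_integral_le_of_norm_le_const (C := ‖φ - ψ‖ * 4) (ae_of_all _ fun k => ?_)).trans ?_
    · rw [← sub_mul, norm_mul]
      exact mul_le_mul ((φ - ψ).norm_coe_le_norm k) (hf4 _) (norm_nonneg _) (norm_nonneg _)
    · simp [mul_comm]
  refine ⟨fun n => I (TopologicalSpace.denseSeq C(K, ℝ) n), fun n => ?_, fun n x => ?_,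
    fun x y hxy => ?_⟩
  · have : StronglyMeasurable (fun p : X × K =>
        TopologicalSpace.denseSeq C(K, ℝ) n p.2 * f (β p.2 p.1)) := by
      refine Measurable.stronglyMeasurable ?_
      exact ((TopologicalSpace.denseSeq C(K, ℝ) n).continuous.measurable.comp measurable_snd).mul
        (hfm.comp (hβ.comp measurable_swap))
    exact this.integral_prod_right'.measurable
  · set φ := TopologicalSpace.denseSeq C(K, ℝ) n
    -- right invariance moves the translation from the measurable function to the continuous one
    have key : ∀ l, I φ (β l x) = ∫ k, φ (k * l⁻¹) * f (β k x) ∂m := by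
      intro l
      rw [← integral_mul_right_eq_self (μ := m) _ l]
      simp [I, map_mul, Equiv.Perm.mul_apply]
    change Continuous fun l => I φ (β l x)
    rw [funext key]
    refine continuous_of_dominated (bound := fun _ => ‖φ‖ * 4) (fun l => ?_)
      (fun l => ae_of_all _ fun k => ?_) (integrable_const _) (ae_of_all _ fun k => ?_)
    · exact ((φ.continuous.comp (continuous_mul_const _)).measurable.mul
        (hF x)).aestronglyMeasurable
    · rw [norm_mul]
      exact mul_le_mul (φ.norm_coe_le_norm _) (hf4 _) (norm_nonneg _) (norm_nonneg _)
    · fun_prop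
  · have hI : (fun φ => I φ x) = fun φ => I φ y :=
      (TopologicalSpace.denseRange_denseSeq C(K, ℝ)).equalizer (hcont x) (hcont y) (funext hxy)
    let ν : X → Measure K := fun z => m.withDensity fun k => ENNReal.ofReal (f (β k z))
    have hνfin : ∀ z, IsFiniteMeasure (ν z) := fun z => by
      refine isFiniteMeasure_withDensity_ofReal ?_
      have := (hint 1 z).2
      simpa using this
    have hνint : ∀ (z : X) (φ : C(K, ℝ)), ∫ k, φ k ∂(ν z) = I φ z := by
      intro z φ
      have := integral_withDensity_eq_integral_toReal_smul (μ := m)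
        (f := fun k => ENNReal.ofReal (f (β k z))) (hF z).ennreal_ofReal
        (ae_of_all _ fun k => ENNReal.ofReal_lt_top) (fun k => φ k)
      rw [this]
      refine integral_congr_ae (ae_of_all _ fun k => ?_)
      simp only [ENNReal.toReal_ofReal (hf0 _), smul_eq_mul, mul_comm]
    have hν : ν x = ν y := by
      have := hνfin x
      have := hνfin y
      refine ext_of_forall_integral_eq_of_IsFiniteMeasure fun φ => ?_
      have := (hνint x φ.toContinuousMap).trans
        ((congrFun hI φ.toContinuousMap).trans (hνint y φ.toContinuousMap).symm)
      exact this
    have hae : (fun k => ENNReal.ofReal (f (β k x))) =ᵐ[m] fun k => ENNReal.ofReal (f (β k y)) :=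
      (withDensity_eq_iff_of_sigmaFinite (hF x).ennreal_ofReal.aemeasurable
        (hF y).ennreal_ofReal.aemeasurable).1 hν
    obtain ⟨k, hk⟩ := hae.exists
    rw [ENNReal.ofReal_eq_ofReal_iff (hf0 _) (hf0 _)] at hk
    exact (β k).injective (hfi hk)

/-- By compactness, the existential quantifier over `K` can be replaced by one over a countable
dense set, at the price of an arbitrarily small error. -/
theorem measurableSet_exists_le_zero {K X : Type*} [TopologicalSpace K] [CompactSpace K]
    [SecondCountableTopology K] [Nonempty K] [MeasurableSpace X] (g : X → K → ℝ)
    (hg : ∀ k, Measurable fun x => g x k) (hc : ∀ x, Continuous (g x)) :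
    MeasurableSet {x | ∃ k, g x k ≤ 0} := by
  have : {x | ∃ k, g x k ≤ 0} =
      ⋂ n : ℕ, ⋃ i : ℕ, {x | g x (TopologicalSpace.denseSeq K i) < 1 / ((n : ℝ) + 1)} := by
    ext x
    simp only [Set.mem_ofPred_eq, Set.mem_iInter, Set.mem_iUnion]
    constructor
    · rintro ⟨k, hk⟩ n
      have ho : IsOpen {l | g x l < 1 / ((n : ℝ) + 1)} := isOpen_lt (hc x) continuous_const
      obtain ⟨i, hi⟩ := (TopologicalSpace.denseRange_denseSeq K).exists_mem_open ho
        ⟨k, lt_of_le_of_lt hk Nat.one_div_pos_of_nat⟩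
      exact ⟨i, hi⟩
    · intro h
      obtain ⟨k, -, hk⟩ := isCompact_univ.exists_isMinOn (Set.univ_nonempty (α := K))
        (hc x).continuousOn
      refine ⟨k, le_of_forall_pos_lt_add fun ε hε => ?_⟩
      obtain ⟨n, hn⟩ := exists_nat_one_div_lt hε
      obtain ⟨i, hi⟩ := h n
      have := hk (Set.mem_univ (TopologicalSpace.denseSeq K i))
      simp only [Set.mem_ofPred_eq] at this
      linarith
  rw [this]
  exact MeasurableSet.iInter fun n => MeasurableSet.iUnion fun i =>
    measurableSet_lt (hg _) measurable_const

/-- A map between standard Borel spaces with Borel graph is Borel: the preimages of Borel sets are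
injective projections of Borel subsets of the graph (Lusin–Souslin). -/
theorem measurable_of_measurableSet_graph {X Z : Type*} [MeasurableSpace X] [StandardBorelSpace X]
    [MeasurableSpace Z] [StandardBorelSpace Z] (f : X → Z)
    (hf : MeasurableSet {p : X × Z | p.2 = f p.1}) : Measurable f := by
  intro B hB
  have : f ⁻¹' B = Prod.fst '' ({p : X × Z | p.2 = f p.1} ∩ Prod.snd ⁻¹' B) := by
    ext x
    constructor
    · intro hx
      exact ⟨(x, f x), ⟨rfl, hx⟩, rfl⟩
    · rintro ⟨⟨x', z⟩, ⟨h, hz⟩, rfl⟩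
      change f x' ∈ B
      rw [← show z = f x' from h]
      exact hz
  rw [this]
  refine (hf.inter (measurable_snd hB)).image_of_measurable_injOn measurable_fst ?_
  rintro ⟨x, z⟩ ⟨h₁, -⟩ ⟨x', z'⟩ ⟨h₂, -⟩ h
  obtain rfl : x = x' := h
  exact Prod.ext rfl ((show z = f x from h₁).trans (show z' = f x from h₂).symm)

/-- The set `{lexPenalty g n x ≤ 0}` consists of the `k` that minimise `(g 0 x k, …, g (n-1) x k)`
in the lexicographic order. -/
noncomputable def lexPenalty {K X : Type*} (g : ℕ → X → K → ℝ) : ℕ → X → K → ℝ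
  | 0 => fun _ _ => 0
  | n + 1 => fun x k =>
      max (lexPenalty g n x k) (g n x k - sInf (g n x '' {l | lexPenalty g n x l ≤ 0}))

theorem lexPenalty_regular {K X : Type*} [TopologicalSpace K] [CompactSpace K]
    [SecondCountableTopology K] [Nonempty K] [MeasurableSpace X] (g : ℕ → X → K → ℝ)
    (hg : ∀ n k, Measurable fun x => g n x k) (hc : ∀ n x, Continuous (g n x)) (n : ℕ) :
    (∀ k, Measurable fun x => lexPenalty g n x k) ∧ (∀ x, Continuous (lexPenalty g n x)) ∧
      ∀ x, ∃ k, lexPenalty g n x k ≤ 0 := by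
  induction n with
  | zero => exact ⟨fun _ => measurable_const, fun _ => continuous_const, fun _ =>
      ⟨Classical.arbitrary K, le_rfl⟩⟩
  | succ n ih =>
    obtain ⟨ihm, ihc, ihe⟩ := ih
    have hcpt : ∀ x, IsCompact {l | lexPenalty g n x l ≤ 0} := fun x =>
      (isClosed_le (ihc x) continuous_const).isCompact
    have hmin : ∀ x, ∃ k, lexPenalty g n x k ≤ 0 ∧
        g n x k = sInf (g n x '' {l | lexPenalty g n x l ≤ 0}) := fun x => by
      obtain ⟨k, hk, h, -⟩ := (hcpt x).exists_sInf_image_eq_and_le (ihe x) (hc n x).continuousOn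
      exact ⟨k, hk, h.symm⟩
    have hle : ∀ x k, lexPenalty g n x k ≤ 0 →
        sInf (g n x '' {l | lexPenalty g n x l ≤ 0}) ≤ g n x k := fun x k hk =>
      csInf_le ((hcpt x).image (hc n x)).bddBelow ⟨k, hk, rfl⟩
    have hmeas : Measurable fun x => sInf (g n x '' {l | lexPenalty g n x l ≤ 0}) := by
      refine measurable_of_Iic fun t => ?_
      have : (fun x => sInf (g n x '' {l | lexPenalty g n x l ≤ 0})) ⁻¹' Set.Iic t =
          {x | ∃ k, max (lexPenalty g n x k) (g n x k - t) ≤ 0} := by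
        ext x
        simp only [Set.mem_preimage, Set.mem_Iic, Set.mem_ofPred_eq, max_le_iff, sub_nonpos]
        constructor
        · intro h
          obtain ⟨k, hk, hk'⟩ := hmin x
          exact ⟨k, hk, hk' ▸ h⟩
        · rintro ⟨k, hk, hk'⟩
          exact (hle x k hk).trans hk'
      rw [this]
      exact measurableSet_exists_le_zero _ (fun k => (ihm k).max ((hg n k).sub_const t))
        fun x => (ihc x).max ((hc n x).sub continuous_const)
    refine ⟨fun k => (ihm k).max ((hg n k).sub hmeas),
      fun x => (ihc x).max ((hc n x).sub continuous_const), fun x => ?_⟩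
    obtain ⟨k, hk, hk'⟩ := hmin x
    exact ⟨k, max_le hk (by rw [hk', sub_self])⟩

theorem lexPenalty_smul {K X : Type*} [Group K] (β : K →* Equiv.Perm X) (h : ℕ → X → ℝ) (n : ℕ)
    (l : K) (x : X) (k : K) :
    lexPenalty (fun n x k => h n (β k x)) n (β l x) k =
      lexPenalty (fun n x k => h n (β k x)) n x (k * l) := by
  induction n generalizing k with
  | zero => rfl
  | succ n ih =>
    have : (fun k => h n (β k (β l x))) '' {j | lexPenalty (fun n x k => h n (β k x)) n (β l x) j ≤ 0}
        = (fun k => h n (β k x)) '' {j | lexPenalty (fun n x k => h n (β k x)) n x j ≤ 0} := by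
      ext t
      constructor
      · rintro ⟨j, hj, rfl⟩
        refine ⟨j * l, ?_, by simp [Equiv.Perm.mul_apply]⟩
        rwa [Set.mem_ofPred_eq, ← ih]
      · rintro ⟨j, hj, rfl⟩
        refine ⟨j * l⁻¹, ?_, by simp [Equiv.Perm.mul_apply]⟩
        rwa [Set.mem_ofPred_eq, ih, inv_mul_cancel_right]
    simp only [lexPenalty, ih, this]
    simp [Equiv.Perm.mul_apply]

/-- A free Borel action of a compact group admits a Borel equivariant map to the group: `(c x)⁻¹`
moves `x` to the point of its orbit at which a separating sequence of functions is
lexicographically minimal. -/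
theorem exists_measurable_equivariant_of_free {K X : Type*} [Group K] [TopologicalSpace K]
    [IsTopologicalGroup K] [T2Space K]
    [CompactSpace K] [SecondCountableTopology K] [MeasurableSpace K] [BorelSpace K]
    [MeasurableSpace X] [StandardBorelSpace X] (β : K →* Equiv.Perm X)
    (hβ : Measurable fun p : K × X => β p.1 p.2) (hfree : ∀ x k, β k x = x → k = 1) :
    ∃ c : X → K, Measurable c ∧ ∀ l x, c (β l x) = l * c x := by
  have := polishSpace_of_compact K
  obtain ⟨h, hm, hc, hsep⟩ := exists_separating_continuous_on_orbits β hβ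
  set g : ℕ → X → K → ℝ := fun n x k => h n (β k x) with hg
  have hgm : ∀ n k, Measurable fun x => g n x k := fun n k =>
    (hm n).comp (hβ.comp (measurable_const.prodMk measurable_id))
  have hreg := fun n => lexPenalty_regular g hgm hc n
  have hex : ∀ x, ∃ k, ∀ n, lexPenalty g n x k ≤ 0 := by
    intro x
    have hcl : ∀ n, IsClosed {k | lexPenalty g n x k ≤ 0} := fun n =>
      isClosed_le ((hreg n).2.1 x) continuous_const
    obtain ⟨k, hk⟩ := IsCompact.nonempty_iInter_of_sequence_nonempty_isCompact_isClosed
      (fun n => {k | lexPenalty g n x k ≤ 0}) (fun n k (hk : lexPenalty g (n + 1) x k ≤ 0) => (le_max_left _ _).trans hk)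
      (fun n => (hreg n).2.2 x) (hcl 0).isCompact hcl
    exact ⟨k, fun n => Set.mem_iInter.1 hk n⟩
  have huniq : ∀ x k l, (∀ n, lexPenalty g n x k ≤ 0) → (∀ n, lexPenalty g n x l ≤ 0) → k = l := by
    have hle : ∀ x k l, (∀ n, lexPenalty g n x k ≤ 0) → (∀ n, lexPenalty g n x l ≤ 0) →
        ∀ n, g n x k ≤ g n x l := by
      intro x k l hk hl n
      have h1 : g n x k ≤ sInf (g n x '' {j | lexPenalty g n x j ≤ 0}) :=
        sub_nonpos.1 ((le_max_right _ _).trans (hk (n + 1)))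
      have hcpt : IsCompact {j | lexPenalty g n x j ≤ 0} :=
        (isClosed_le ((hreg n).2.1 x) continuous_const).isCompact
      exact h1.trans (csInf_le (hcpt.image (hc n x)).bddBelow ⟨l, hl n, rfl⟩)
    intro x k l hk hl
    have : β k x = β l x := hsep _ _ fun n => le_antisymm (hle x k l hk hl n) (hle x l k hl hk n)
    have h1 := hfree x (l⁻¹ * k) (by
      rw [map_mul, Equiv.Perm.mul_apply, this, ← Equiv.Perm.mul_apply, ← map_mul]; simp)
    exact (inv_mul_eq_one.1 h1).symm
  choose κ hκ using hex
  have hκm : Measurable κ := by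
    refine measurable_of_measurableSet_graph κ ?_
    have : {p : X × K | p.2 = κ p.1} = ⋂ n, {p : X × K | lexPenalty g n p.1 p.2 ≤ 0} := by
      ext p
      simp only [Set.mem_ofPred_eq, Set.mem_iInter]
      exact ⟨fun hp => hp ▸ hκ p.1, fun hp => huniq _ _ _ hp (hκ p.1)⟩
    rw [this]
    refine MeasurableSet.iInter fun n => measurableSet_le ?_ measurable_const
    have := measurable_uncurry_of_continuous_of_measurable (u := fun k x => lexPenalty g n x k)
      (fun x => (hreg n).2.1 x) (fun k => (hreg n).1 k)
    exact this.comp measurable_swap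
  refine ⟨fun x => (κ x)⁻¹, hκm.inv, fun l x => ?_⟩
  have : κ (β l x) * l = κ x := huniq x _ _
    (fun n => by rw [← lexPenalty_smul β h]; exact hκ (β l x) n) (hκ x)
  simp only [← this, mul_inv_rev, mul_inv_cancel_left]

/-- The restriction of an action to an invariant subset. -/
def restrictAction {G X : Type*} [Group G] (α : G →* Equiv.Perm X) (A : Set X)
    (hA : ∀ g, ∀ x ∈ A, α g x ∈ A) : G →* Equiv.Perm A where
  toFun g :=
    { toFun := fun x => ⟨α g x, hA g x x.2⟩
      invFun := fun x => ⟨α g⁻¹ x, hA g⁻¹ x x.2⟩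
      left_inv := fun x => Subtype.ext (by simp)
      right_inv := fun x => Subtype.ext (by simp) }
  map_one' := by ext x; simp
  map_mul' g h := by ext x; simp

theorem exists_measurable_equivariantOn {K X : Type*} [Group K] [TopologicalSpace K]
    [IsTopologicalGroup K] [T2Space K]
    [CompactSpace K] [SecondCountableTopology K] [MeasurableSpace K] [BorelSpace K]
    [MeasurableSpace X] [StandardBorelSpace X] (β : K →* Equiv.Perm X)
    (hβ : Measurable fun p : K × X => β p.1 p.2) {A : Set X} (hA : MeasurableSet A)
    (hinv : ∀ k, ∀ x ∈ A, β k x ∈ A) (hfree : ∀ x ∈ A, ∀ k, β k x = x → k = 1) :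
    ∃ c : X → K, Measurable c ∧ ∀ x ∈ A, ∀ l, c (β l x) = l * c x := by
  classical
  have := hA.standardBorel
  obtain ⟨c, hc, hcl⟩ := exists_measurable_equivariant_of_free (restrictAction β A hinv)
    ((hβ.comp (measurable_fst.prodMk (measurable_subtype_coe.comp measurable_snd))).subtype_mk)
    (fun x k hk => hfree x x.2 k (congrArg Subtype.val hk))
  refine ⟨fun x => if h : x ∈ A then c ⟨x, h⟩ else 1, hc.dite measurable_const hA,
    fun x hx l => ?_⟩
  simp only [hx, hinv l x hx, dif_pos]
  exact hcl l ⟨x, hx⟩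

/-- An invariant property that holds almost everywhere holds on an invariant *measurable* conull
set: if `t` is a measurable conull set on which it holds, then the points whose `K`-orbit lies almost
entirely in `t`, and likewise for all their `H`-translates, form such a set. -/
theorem exists_invariant_conull {H K X : Type*} [Group H] [Countable H] [MeasurableSpace H]
    [DiscreteMeasurableSpace H] [Group K] [TopologicalSpace K] [IsTopologicalGroup K]
    [CompactSpace K] [SecondCountableTopology K] [MeasurableSpace K] [BorelSpace K]
    [MeasurableSpace X] {μ : Measure X} [IsProbabilityMeasure μ]
    {α : H × K →* Equiv.Perm X} (hα : IsPMP α μ) {P : X → Prop} (hP : ∀ᵐ x ∂μ, P x)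
    (hinv : ∀ g x, P x → P (α g x)) :
    ∃ A : Set X, MeasurableSet A ∧ (∀ᵐ x ∂μ, x ∈ A) ∧ (∀ g, ∀ x ∈ A, α g x ∈ A) ∧
      ∀ x ∈ A, P x := by
  obtain ⟨m, hm, hminv⟩ := exists_rightInvariant_probabilityMeasure K
  set t : Set X := (toMeasurable μ {x | ¬ P x})ᶜ with ht
  have htm : MeasurableSet t := (measurableSet_toMeasurable _ _).compl
  have htP : ∀ x ∈ t, P x := fun x hx => by
    by_contra h
    exact hx (subset_toMeasurable μ {x | ¬ P x} h)
  have htae : ∀ᵐ x ∂μ, x ∈ t := by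
    rw [ae_iff]
    simp only [ht, Set.mem_compl_iff, not_not, Set.ofPred_mem_eq, measure_toMeasurable]
    exact hP
  have hE : ∀ h : H, MeasurableSet {p : X × K | α (h, p.2) p.1 ∈ t} := fun h =>
    (hα.measurable.comp ((measurable_const.prodMk measurable_snd).prodMk measurable_fst)) htm
  refine ⟨{x | ∀ h : H, m {k | α (h, k) x ∉ t} = 0}, ?_, ?_, ?_, ?_⟩
  · simp only [Set.ofPred_forall]
    refine MeasurableSet.iInter fun h => ?_
    exact (measurable_measure_prodMk_left (hE h).compl) (measurableSet_singleton 0)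
  · change ∀ᵐ x ∂μ, ∀ h : H, ∀ᵐ k ∂m, α (h, k) x ∈ t
    rw [ae_all_iff]
    intro h
    rw [Measure.ae_ae_comm (hE h)]
    exact ae_of_all _ fun k => (hα.measurePreserving (h, k)).quasiMeasurePreserving.ae htae
  · rintro ⟨h', k'⟩ x hx h
    rw [← hx (h * h'), ← measure_preimage_mul_right m k' {k | α (h * h', k) x ∉ t}]
    simp [← Equiv.Perm.mul_apply, ← map_mul]
  · intro x hx
    have h1 : ∀ᵐ k ∂m, α (1, k) x ∈ t := hx 1
    obtain ⟨k, hk⟩ := h1.exists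
    have := hinv (1, k)⁻¹ _ (htP _ hk)
    rwa [← Equiv.Perm.mul_apply, ← map_mul, inv_mul_cancel, map_one] at this

/-- Averaging over the compact group, an invariant finite measure is determined by its values on
invariant sets. -/
theorem measure_eq_of_eq_on_invariant {K X : Type*} [Group K] [TopologicalSpace K]
    [IsTopologicalGroup K]
    [CompactSpace K] [SecondCountableTopology K] [MeasurableSpace K] [BorelSpace K]
    [MeasurableSpace X] (β : K →* Equiv.Perm X)
    (hβ : Measurable fun p : K × X => β p.1 p.2) (μ ν : Measure X) [IsFiniteMeasure μ]
    [IsFiniteMeasure ν] (hμ : ∀ k, MeasurePreserving (β k) μ μ)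
    (hν : ∀ k, MeasurePreserving (β k) ν ν)
    (h : ∀ S, MeasurableSet S → (∀ k x, x ∈ S → β k x ∈ S) → μ S = ν S) : μ = ν := by
  obtain ⟨m, hm, hminv⟩ := exists_rightInvariant_probabilityMeasure K
  ext B hB
  set f : X → ENNReal := fun x => m {k | β k x ∈ B} with hf
  have hE : MeasurableSet {p : X × K | β p.2 p.1 ∈ B} := (hβ.comp measurable_swap) hB
  have hfm : Measurable f := measurable_measure_prodMk_left hE
  have hfinv : ∀ k x, f (β k x) = f x := fun k x => by
    simp only [hf]
    rw [← measure_preimage_mul_right m k {l | β l x ∈ B}]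
    simp
  have key : ∀ (ρ : Measure X) [IsFiniteMeasure ρ], (∀ k, MeasurePreserving (β k) ρ ρ) →
      ρ B = ∫⁻ x, f x ∂ρ := by
    intro ρ _ hρ
    have h1 : (ρ.prod m) {p : X × K | β p.2 p.1 ∈ B} = ∫⁻ x, f x ∂ρ := Measure.prod_apply hE
    have h2 := Measure.prod_apply_symm (μ := ρ) (ν := m) hE
    rw [← h1, h2]
    have : ∀ k, ρ ((fun x => (x, k)) ⁻¹' {p : X × K | β p.2 p.1 ∈ B}) = ρ B := fun k =>
      (hρ k).measure_preimage hB.nullMeasurableSet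
    rw [lintegral_congr this]
    simp
  have hmap : μ.map f = ν.map f := by
    ext T hT
    rw [Measure.map_apply hfm hT, Measure.map_apply hfm hT]
    exact h _ (hfm hT) fun k x hx => by
      rw [Set.mem_preimage, hfinv]; exact hx
  have e := fun ρ : Measure X => lintegral_map (μ := ρ) measurable_id hfm
  simp only [id] at e
  rw [key μ hμ, key ν hν, ← e μ, ← e ν, hmap]

/-! ### Actions over a base and the universal property of co-induction -/

section Terminal

variable {Λ G K X W : Type*} [Group Λ] [Group G] [Group K]

/-- A map `p : W → X` from a `G × K`-space to a `Λ × K`-space is equivariant along `ι : Λ →* G`. -/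
def EquivariantAlong (ι : Λ →* G) (A : G × K →* Equiv.Perm W) (α : Λ × K →* Equiv.Perm X)
    (p : W → X) : Prop :=
  ∀ (l : Λ) (k : K) (w : W), p (A (ι l, k) w) = α (l, k) (p w)

/-- The evaluation of `y ∈ X ^ (Λ \ G)` at the trivial coset. -/
def root (ι : Λ →* G) (y : RightCosets ι → X) : X := y (coset ι 1)

theorem coset_eq_iff {ι : Λ →* G} {a b : G} : coset ι a = coset ι b ↔ ∃ l, b = ι l * a := by
  refine Quotient.eq.trans ?_
  rw [QuotientGroup.rightRel_apply]
  constructor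
  · rintro ⟨l, hl⟩
    exact ⟨l, by rw [hl]; group⟩
  · rintro ⟨l, hl⟩
    exact ⟨l, by rw [hl]; group⟩

theorem exists_coset_eq {ι : Λ →* G} (c : RightCosets ι) : ∃ a, coset ι a = c :=
  ⟨c.out, Quotient.out_eq c⟩

theorem EquivariantMap.apply_range {ι : Λ →* G} (r : EquivariantMap ι) (l : Λ) :
    r.toFun (ι l) = l := by
  have := r.map_mul l 1
  rwa [r.map_one, mul_one, mul_one] at this

variable {ι : Λ →* G} (r : EquivariantMap ι) (α : Λ × K →* Equiv.Perm X)

theorem coinducedProdAction_coset (g : G) (k : K) (y : RightCosets ι → X) (a : G) :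
    coinducedProdAction r α (g, k) y (coset ι a) =
      α ((r.toFun a)⁻¹ * r.toFun (a * g), k) (y (coset ι (a * g))) := by
  have h : coinducedProdAction r α (g, k) y (coset ι a) =
      α ((r.toFun a)⁻¹ * r.toFun (a * g), 1) (α (1, k) (y (coset ι (a * g)))) := rfl
  rw [h, ← Equiv.Perm.mul_apply, ← map_mul]
  simp

theorem root_coinducedProdAction (g : G) (k : K) (y : RightCosets ι → X) :
    root ι (coinducedProdAction r α (g, k) y) = α (r.toFun g, k) (y (coset ι g)) := by
  rw [root, coinducedProdAction_coset, r.map_one]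
  simp

theorem equivariantAlong_root : EquivariantAlong ι (coinducedProdAction r α) α (root ι) := by
  intro l k y
  rw [root_coinducedProdAction, r.apply_range, root]
  congr 2
  exact coset_eq_iff.2 ⟨l⁻¹, by simp⟩

/-- A point of the co-induced space is determined by the evaluations at the trivial coset along its
`G`-orbit; this is the uniqueness part of the universal property. -/
theorem eq_of_root_coinducedProdAction_eq {y y' : RightCosets ι → X}
    (h : ∀ a, root ι (coinducedProdAction r α (a, 1) y) =
      root ι (coinducedProdAction r α (a, 1) y')) : y = y' := by
  funext c
  obtain ⟨a, rfl⟩ := exists_coset_eq c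
  have := h a
  rw [root_coinducedProdAction, root_coinducedProdAction] at this
  exact (α _).injective this

/-- The map into the co-induced space determined by an equivariant map `p : W → X`. -/
noncomputable def toCoinduced (A : G × K →* Equiv.Perm W) (p : W → X) (w : W) :
    RightCosets ι → X :=
  fun c => α ((r.toFun c.out)⁻¹, 1) (p (A (c.out, 1) w))

variable {r α} {A : G × K →* Equiv.Perm W} {p : W → X}

/-- The definition of `toCoinduced` does not depend on the choice of representatives. -/
theorem toCoinduced_coset (hp : EquivariantAlong ι A α p) (w : W) (a : G) :
    toCoinduced r α A p w (coset ι a) = α ((r.toFun a)⁻¹, 1) (p (A (a, 1) w)) := by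
  obtain ⟨l, hl⟩ := coset_eq_iff.1 (Quotient.out_eq (coset ι a)).symm
  simp only [toCoinduced]
  rw [hl, r.map_mul, ← one_mul (1 : K), ← Prod.mk_mul_mk, one_mul, map_mul, Equiv.Perm.mul_apply, hp,
    ← Equiv.Perm.mul_apply, ← map_mul]
  simp

theorem root_toCoinduced (hp : EquivariantAlong ι A α p) (w : W) :
    root ι (toCoinduced r α A p w) = p w := by
  rw [root, toCoinduced_coset hp, r.map_one, inv_one, ← Prod.one_eq_mk, ← Prod.one_eq_mk, map_one,
    map_one]
  rfl

theorem toCoinduced_smul (hp : EquivariantAlong ι A α p) (g : G × K) (w : W) :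
    toCoinduced r α A p (A g w) = coinducedProdAction r α g (toCoinduced r α A p w) := by
  obtain ⟨g, k⟩ := g
  funext c
  obtain ⟨a, rfl⟩ := exists_coset_eq c
  have hk : ∀ w, p (A (1, k) w) = α (1, k) (p w) := fun w => by
    have := hp 1 k w
    rwa [map_one] at this
  rw [coinducedProdAction_coset, toCoinduced_coset hp, toCoinduced_coset hp,
    ← Equiv.Perm.mul_apply, ← Equiv.Perm.mul_apply, ← map_mul, ← map_mul]
  have h1 : ((a, 1) * (g, k) : G × K) = (1, k) * (a * g, 1) := by simp
  rw [h1, map_mul, Equiv.Perm.mul_apply, hk, ← Equiv.Perm.mul_apply, ← map_mul]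
  simp

/-- Co-induction is functorial in the base. -/
theorem coinducedProdAction_comp {X' : Type*} {α' : Λ × K →* Equiv.Perm X'} {f : X → X'}
    (hf : ∀ g x, f (α g x) = α' g (f x)) (g : G × K) (y : RightCosets ι → X) :
    (f ∘ coinducedProdAction r α g y) = coinducedProdAction r α' g (f ∘ y) := by
  obtain ⟨g, k⟩ := g
  funext c
  obtain ⟨a, rfl⟩ := exists_coset_eq c
  simp [coinducedProdAction_coset, hf]

end Terminal

/-! ### Changing the group while keeping the orbits -/

section Rewiring

variable {Γ Λ₀ Λ₁ K X W : Type*} [Group Γ] [Group Λ₀] [Group Λ₁] [Group K]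

/-- Free actions of `Λ₀ × K` and `Λ₁ × K` on one set that agree on `K` and have the same orbits. -/
structure SameOrbits (α₀ : Λ₀ × K →* Equiv.Perm X) (α₁ : Λ₁ × K →* Equiv.Perm X) : Prop where
  free₀ : ∀ g x, α₀ g x = x → g = 1
  free₁ : ∀ g x, α₁ g x = x → g = 1
  agree : ∀ k x, α₀ (1, k) x = α₁ (1, k) x
  sub₀ : ∀ g x, ∃ h, α₁ h x = α₀ g x
  sub₁ : ∀ h x, ∃ g, α₀ g x = α₁ h x

variable {α₀ : Λ₀ × K →* Equiv.Perm X} {α₁ : Λ₁ × K →* Equiv.Perm X}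

theorem SameOrbits.symm (M : SameOrbits α₀ α₁) : SameOrbits α₁ α₀ :=
  ⟨M.free₁, M.free₀, fun k x => (M.agree k x).symm, M.sub₁, M.sub₀⟩

namespace SameOrbits

variable (M : SameOrbits α₀ α₁)

/-- The Zimmer cocycle: `cocycle h x` is the element of `Λ₀ × K` that moves `x` as `h` does. -/
noncomputable def cocycle (h : Λ₁ × K) (x : X) : Λ₀ × K := (M.sub₁ h x).choose

theorem cocycle_spec (h : Λ₁ × K) (x : X) : α₀ (M.cocycle h x) x = α₁ h x :=
  (M.sub₁ h x).choose_spec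

theorem cocycle_eq {h : Λ₁ × K} {x : X} {g : Λ₀ × K} (hg : α₀ g x = α₁ h x) :
    M.cocycle h x = g := by
  have h1 : α₀ (g⁻¹ * M.cocycle h x) x = x := by
    rw [map_mul, Equiv.Perm.mul_apply, cocycle_spec, ← hg, ← Equiv.Perm.mul_apply, ← map_mul]
    simp
  exact (inv_mul_eq_one.1 (M.free₀ _ _ h1)).symm

theorem cocycle_one (x : X) : M.cocycle 1 x = 1 := M.cocycle_eq (by simp)

theorem cocycle_mul (h h' : Λ₁ × K) (x : X) :
    M.cocycle (h * h') x = M.cocycle h (α₁ h' x) * M.cocycle h' x :=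
  M.cocycle_eq (by
    rw [map_mul, map_mul, Equiv.Perm.mul_apply, Equiv.Perm.mul_apply, cocycle_spec, cocycle_spec])

theorem cocycle_compact (k : K) (x : X) : M.cocycle (1, k) x = (1, k) := M.cocycle_eq (M.agree k x)

theorem cocycle_symm (h : Λ₁ × K) (x : X) : M.symm.cocycle (M.cocycle h x) x = h :=
  M.symm.cocycle_eq (M.cocycle_spec h x).symm

end SameOrbits

theorem coprod_prod_induction {motive : Monoid.Coprod Γ Λ₀ × K → Prop}
    (inl : ∀ γ, motive (Monoid.Coprod.inl γ, 1)) (inr : ∀ l k, motive (freeFactor Γ Λ₀ l, k))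
    (mul : ∀ a b, motive a → motive b → motive (a * b)) (g : Monoid.Coprod Γ Λ₀ × K) :
    motive g := by
  obtain ⟨g, k⟩ := g
  have h1 : motive (g, 1) := by
    induction g using Monoid.Coprod.induction_on with
    | inl γ => exact inl γ
    | inr l => exact inr l 1
    | mul x y hx hy => simpa using mul _ _ hx hy
  have h2 := mul _ _ h1 (inr 1 k)
  simpa using h2

namespace SameOrbits

variable (M : SameOrbits α₀ α₁) {A : Monoid.Coprod Γ Λ₀ × K →* Equiv.Perm W} {p : W → X}

/-- The action of `Λ₁ × K` on `W` with the orbits of `Λ₀ × K`, moving `w` through the cocycle at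
`p w`. -/
noncomputable def rewireVertex (hp : EquivariantAlong (freeFactor Γ Λ₀) A α₀ p) :
    Λ₁ × K →* Equiv.Perm W :=
  letI : MulAction (Λ₁ × K) W :=
    { smul := fun h w => A (freeFactor Γ Λ₀ (M.cocycle h (p w)).1, (M.cocycle h (p w)).2) w
      one_smul := fun w => by
        change A (freeFactor Γ Λ₀ (M.cocycle 1 (p w)).1, (M.cocycle 1 (p w)).2) w = w
        rw [M.cocycle_one, Prod.fst_one, Prod.snd_one, map_one, ← Prod.one_eq_mk, map_one]
        rfl
      mul_smul := fun h h' w => by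
        change A (freeFactor Γ Λ₀ (M.cocycle (h * h') (p w)).1, (M.cocycle (h * h') (p w)).2) w =
          A (freeFactor Γ Λ₀ (M.cocycle h (p (A _ w))).1, (M.cocycle h (p (A _ w))).2) (A _ w)
        rw [hp, M.cocycle_spec, ← Equiv.Perm.mul_apply, ← map_mul, M.cocycle_mul, Prod.fst_mul,
          Prod.snd_mul, map_mul (freeFactor Γ Λ₀), Prod.mk_mul_mk] }
  MulAction.toPermHom (Λ₁ × K) W

theorem rewireVertex_apply (hp : EquivariantAlong (freeFactor Γ Λ₀) A α₀ p) (h : Λ₁ × K) (w : W) :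
    M.rewireVertex hp h w =
      A (freeFactor Γ Λ₀ (M.cocycle h (p w)).1, (M.cocycle h (p w)).2) w := rfl

theorem rewireVertex_compact (hp : EquivariantAlong (freeFactor Γ Λ₀) A α₀ p) (k : K) :
    M.rewireVertex hp (1, k) = A (1, k) := by
  ext w
  rw [rewireVertex_apply, M.cocycle_compact, map_one]

/-- The action of `(Γ * Λ₁) × K` on `W` in which `Γ` and `K` move points as before and `Λ₁` moves
them along the `Λ₀ × K`-orbits through the cocycle. -/
noncomputable def rewire (hp : EquivariantAlong (freeFactor Γ Λ₀) A α₀ p) :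
    Monoid.Coprod Γ Λ₁ × K →* Equiv.Perm W :=
  (Monoid.Coprod.lift (A.comp ((MonoidHom.inl _ K).comp Monoid.Coprod.inl))
    ((M.rewireVertex hp).comp (MonoidHom.inl Λ₁ K))).noncommCoprod
    ((M.rewireVertex hp).comp (MonoidHom.inr Λ₁ K)) (by
      intro g k
      induction g using Monoid.Coprod.induction_on with
      | inl γ =>
        simp only [Monoid.Coprod.lift_apply_inl, MonoidHom.comp_apply, MonoidHom.inl_apply,
          MonoidHom.inr_apply, rewireVertex_compact]
        rw [commute_iff_eq, ← map_mul, ← map_mul]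
        simp
      | inr l =>
        simp only [Monoid.Coprod.lift_apply_inr, MonoidHom.comp_apply, MonoidHom.inl_apply,
          MonoidHom.inr_apply]
        rw [commute_iff_eq, ← map_mul, ← map_mul]
        simp
      | mul x y hx hy => rw [map_mul]; exact hx.mul_left hy)

variable (hp : EquivariantAlong (freeFactor Γ Λ₀) A α₀ p)

theorem rewire_inl (γ : Γ) (w : W) :
    M.rewire hp (Monoid.Coprod.inl γ, 1) w = A (Monoid.Coprod.inl γ, 1) w := by
  simp [rewire, ← Prod.one_eq_mk]

theorem rewire_freeFactor (l : Λ₁) (k : K) (w : W) : M.rewire hp (freeFactor Γ Λ₁ l, k) w =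
    A (freeFactor Γ Λ₀ (M.cocycle (l, k) (p w)).1, (M.cocycle (l, k) (p w)).2) w := by
  rw [← rewireVertex_apply M hp]
  simp only [rewire, MonoidHom.noncommCoprod_apply, freeFactor, Monoid.Coprod.lift_apply_inr,
    MonoidHom.comp_apply, MonoidHom.inl_apply, MonoidHom.inr_apply, ← map_mul]
  simp

theorem rewire_compact (k : K) (w : W) : M.rewire hp (1, k) w = A (1, k) w := by
  have := M.rewire_freeFactor hp 1 k w
  rwa [M.cocycle_compact, map_one, map_one] at this

theorem equivariantAlong_rewire : EquivariantAlong (freeFactor Γ Λ₁) (M.rewire hp) α₁ p := by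
  intro l k w
  rw [rewire_freeFactor, hp, M.cocycle_spec]

theorem exists_rewire_eq (g : Monoid.Coprod Γ Λ₁ × K) :
    ∀ w, ∃ g', M.rewire hp g w = A g' w := by
  induction g using coprod_prod_induction with
  | inl γ => exact fun w => ⟨_, M.rewire_inl hp γ w⟩
  | inr l k => exact fun w => ⟨_, M.rewire_freeFactor hp l k w⟩
  | mul a b ha hb =>
    intro w
    obtain ⟨b', hb'⟩ := hb w
    obtain ⟨a', ha'⟩ := ha (A b' w)
    exact ⟨a' * b', by rw [map_mul, map_mul, Equiv.Perm.mul_apply, hb', ha', Equiv.Perm.mul_apply]⟩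

theorem map_rewire {W' : Type*} {A' : Monoid.Coprod Γ Λ₀ × K →* Equiv.Perm W'} {p' : W' → X}
    (hp' : EquivariantAlong (freeFactor Γ Λ₀) A' α₀ p') {f : W → W'}
    (hf : ∀ g w, f (A g w) = A' g (f w)) (hfp : ∀ w, p' (f w) = p w)
    (g : Monoid.Coprod Γ Λ₁ × K) : ∀ w, f (M.rewire hp g w) = M.rewire hp' g (f w) := by
  induction g using coprod_prod_induction with
  | inl γ => intro w; rw [rewire_inl, rewire_inl, hf]
  | inr l k => intro w; rw [rewire_freeFactor, rewire_freeFactor, hf, hfp]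
  | mul a b ha hb =>
    intro w
    rw [map_mul, map_mul, Equiv.Perm.mul_apply, Equiv.Perm.mul_apply, ha, hb]

theorem rewire_rewire (g : Monoid.Coprod Γ Λ₀ × K) :
    ∀ w, M.symm.rewire (M.equivariantAlong_rewire hp) g w = A g w := by
  induction g using coprod_prod_induction with
  | inl γ => intro w; rw [rewire_inl, rewire_inl]
  | inr l k =>
    intro w
    rw [rewire_freeFactor, rewire_freeFactor, Prod.mk.eta, M.symm.cocycle_symm]
  | mul a b ha hb =>
    intro w
    rw [map_mul, map_mul, Equiv.Perm.mul_apply, Equiv.Perm.mul_apply, ha, hb]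

end SameOrbits

end Rewiring

namespace SameOrbits

variable {Γ Λ₀ Λ₁ K X W : Type*} [Group Γ] [Group Λ₀] [Group Λ₁] [Group K]
  {α₀ : Λ₀ × K →* Equiv.Perm X} {α₁ : Λ₁ × K →* Equiv.Perm X} (M : SameOrbits α₀ α₁)
  (r₀ : EquivariantMap (freeFactor Γ Λ₀)) (r₁ : EquivariantMap (freeFactor Γ Λ₁))

/-- The map `X ^ (Λ₀ \ (Γ * Λ₀)) → X ^ (Λ₁ \ (Γ * Λ₁))` that the universal property of the target
assigns to the rewired action on the source. -/
noncomputable def theta (y : RightCosets (freeFactor Γ Λ₀) → X) :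
    RightCosets (freeFactor Γ Λ₁) → X :=
  toCoinduced r₁ α₁ (M.rewire (equivariantAlong_root r₀ α₀)) (root _) y

theorem root_theta (y : RightCosets (freeFactor Γ Λ₀) → X) :
    root _ (M.theta r₀ r₁ y) = root _ y :=
  root_toCoinduced (M.equivariantAlong_rewire _) y

theorem theta_rewire (g : Monoid.Coprod Γ Λ₁ × K) (y : RightCosets (freeFactor Γ Λ₀) → X) :
    M.theta r₀ r₁ (M.rewire (equivariantAlong_root r₀ α₀) g y) =
      coinducedProdAction r₁ α₁ g (M.theta r₀ r₁ y) :=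
  toCoinduced_smul (M.equivariantAlong_rewire _) g y

/-- Seen from the target, the original action on the source is the action rewired back. -/
theorem theta_smul (g : Monoid.Coprod Γ Λ₀ × K) (y : RightCosets (freeFactor Γ Λ₀) → X) :
    M.theta r₀ r₁ (coinducedProdAction r₀ α₀ g y) =
      M.symm.rewire (equivariantAlong_root r₁ α₁) g (M.theta r₀ r₁ y) := by
  rw [← M.rewire_rewire (equivariantAlong_root r₀ α₀) g y]
  exact M.symm.map_rewire (M.equivariantAlong_rewire _) (equivariantAlong_root r₁ α₁)
    (M.theta_rewire r₀ r₁) (M.root_theta r₀ r₁) g y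

/-- The map built with the roles of the two groups exchanged is inverse to `theta`: the composition
is an endomorphism of the terminal object. -/
theorem theta_symm_theta (y : RightCosets (freeFactor Γ Λ₀) → X) :
    M.symm.theta r₁ r₀ (M.theta r₀ r₁ y) = y := by
  refine eq_of_root_coinducedProdAction_eq r₀ α₀ fun a => ?_
  rw [← M.symm.theta_rewire r₁ r₀, ← theta_smul, root_theta, root_theta]

/-! ### The labels of the tree of cosets -/

/-- The evaluation at the root along the `G × K`-orbit of `y`. -/
def rootAlong (α : Λ₀ × K →* Equiv.Perm X) (y : RightCosets (freeFactor Γ Λ₀) → X)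
    (w : Monoid.Coprod Γ Λ₀ × K) : X :=
  root _ (coinducedProdAction r₀ α w y)

theorem equivariantAlong_rootAlong (y : RightCosets (freeFactor Γ Λ₀) → X) :
    EquivariantAlong (freeFactor Γ Λ₀) (MulAction.toPermHom (Monoid.Coprod Γ Λ₀ × K) _) α₀
      (rootAlong r₀ α₀ y) := by
  intro l k w
  simp only [rootAlong, MulAction.toPermHom_apply, MulAction.toPerm_apply, smul_eq_mul, map_mul,
    Equiv.Perm.mul_apply]
  exact equivariantAlong_root r₀ α₀ l k _

/-- The element of `(Γ * Λ₀) × K` that moves `y` as `g` does under the rewired action, obtained by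
rewiring the left regular action of `(Γ * Λ₀) × K` over the orbit of `y`. -/
noncomputable def label (y : RightCosets (freeFactor Γ Λ₀) → X) (g : Monoid.Coprod Γ Λ₁ × K) :
    Monoid.Coprod Γ Λ₀ × K :=
  M.rewire (equivariantAlong_rootAlong r₀ y) g 1

variable (y : RightCosets (freeFactor Γ Λ₀) → X)

theorem label_one : M.label r₀ y 1 = 1 := by simp [label]

theorem label_inl_mul (γ : Γ) (g : Monoid.Coprod Γ Λ₁ × K) :
    M.label r₀ y ((Monoid.Coprod.inl γ, 1) * g) = (Monoid.Coprod.inl γ, 1) * M.label r₀ y g := by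
  rw [label, map_mul, Equiv.Perm.mul_apply, rewire_inl]
  rfl

theorem label_freeFactor_mul (l : Λ₁) (k : K) (g : Monoid.Coprod Γ Λ₁ × K) :
    M.label r₀ y ((freeFactor Γ Λ₁ l, k) * g) =
      (freeFactor Γ Λ₀ (M.cocycle (l, k) (rootAlong r₀ α₀ y (M.label r₀ y g))).1,
        (M.cocycle (l, k) (rootAlong r₀ α₀ y (M.label r₀ y g))).2) * M.label r₀ y g := by
  rw [label, map_mul, Equiv.Perm.mul_apply, rewire_freeFactor]
  rfl

theorem smul_label (g : Monoid.Coprod Γ Λ₁ × K) :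
    coinducedProdAction r₀ α₀ (M.label r₀ y g) y =
      M.rewire (equivariantAlong_root r₀ α₀) g y := by
  have := M.map_rewire (equivariantAlong_rootAlong r₀ y) (equivariantAlong_root r₀ α₀)
    (f := fun w => coinducedProdAction r₀ α₀ w y)
    (fun g w => by simp [MulAction.toPermHom_apply]) (fun w => rfl) g 1
  simpa [label] using this

theorem rootAlong_label (g : Monoid.Coprod Γ Λ₁ × K) :
    rootAlong r₀ α₀ y (M.label r₀ y g) = rootAlong r₁ α₁ (M.theta r₀ r₁ y) g := by
  rw [rootAlong, smul_label, ← M.root_theta r₀ r₁, theta_rewire, rootAlong]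

/-- The labels from both sides are inverse to each other: `g ↦ label y g` identifies the regular
action of `(Γ * Λ₁) × K` with the rewired regular action of `(Γ * Λ₀) × K`, and rewiring back recovers
the element. In particular `label y` is injective. -/
theorem label_symm_label (g : Monoid.Coprod Γ Λ₁ × K) :
    M.symm.label r₁ (M.theta r₀ r₁ y) (M.label r₀ y g) = g := by
  set z := M.theta r₀ r₁ y with hz
  have hy : M.symm.theta r₁ r₀ z = y := M.theta_symm_theta r₀ r₁ y
  have hbase : ∀ w, rootAlong r₁ α₁ z (M.symm.label r₁ z w) = rootAlong r₀ α₀ y w := by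
    intro w
    rw [M.symm.rootAlong_label r₁ r₀, hy]
  have := M.map_rewire (equivariantAlong_rootAlong r₀ y)
    (M.symm.equivariantAlong_rewire (equivariantAlong_rootAlong r₁ z))
    (f := M.symm.label r₁ z)
    (fun g w => by
      simp only [label, MulAction.toPermHom_apply, MulAction.toPerm_apply, smul_eq_mul, map_mul,
        Equiv.Perm.mul_apply])
    hbase g 1
  rw [show M.symm.label r₁ z (M.label r₀ y g) = _ from this, label_one]
  have h2 := M.symm.rewire_rewire (equivariantAlong_rootAlong r₁ z) g 1
  rw [show M.symm.symm = M from rfl] at h2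
  rw [h2]
  simp [MulAction.toPermHom_apply]

include r₁ in
/-- Distinct cosets `Λ₁ g` read distinct coordinates `Λ₀ (label y g)` of `y`. -/
theorem coset_eq_of_coset_label_eq {g g' : Monoid.Coprod Γ Λ₁}
    (h : coset (freeFactor Γ Λ₀) (M.label r₀ y (g, 1)).1 =
      coset (freeFactor Γ Λ₀) (M.label r₀ y (g', 1)).1) :
    coset (freeFactor Γ Λ₁) g = coset (freeFactor Γ Λ₁) g' := by
  obtain ⟨l, hl⟩ := coset_eq_iff.1 h
  set z := M.theta r₀ r₁ y
  have h1 : M.label r₀ y (g', 1) =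
      (freeFactor Γ Λ₀ l, (M.label r₀ y (g', 1)).2 * (M.label r₀ y (g, 1)).2⁻¹) *
        M.label r₀ y (g, 1) := by
    ext
    · exact hl
    · simp
  have h2 := congrArg (M.symm.label r₁ z) h1
  rw [label_freeFactor_mul, label_symm_label, label_symm_label] at h2
  exact coset_eq_iff.2 ⟨_, congrArg Prod.fst h2⟩

end SameOrbits

/-! ### Adaptive reading of independent coordinates -/

section Adaptive

variable {I J X : Type*} [MeasurableSpace X] (μ : Measure X) [IsProbabilityMeasure μ]

theorem measurePreserving_update [DecidableEq I] (d : I) :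
    MeasurePreserving (fun p : (I → X) × X => Function.update p.1 d p.2)
      ((Measure.infinitePi fun _ : I => μ).prod μ) (Measure.infinitePi fun _ : I => μ) := by
  have hm : Measurable (fun p : (I → X) × X => Function.update p.1 d p.2) := by
    refine measurable_pi_iff.2 fun i => ?_
    by_cases h : i = d
    · subst h
      simpa using measurable_snd
    · simp only [Function.update_of_ne h]
      exact (measurable_pi_apply i).comp measurable_fst
  refine ⟨hm, Measure.eq_infinitePi _ fun s t ht => ?_⟩
  rw [Measure.map_apply hm (MeasurableSet.pi s.countable_toSet fun i _ => ht i)]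
  by_cases hd : d ∈ s
  · have : (fun p : (I → X) × X => Function.update p.1 d p.2) ⁻¹' (s : Set I).pi t =
        ((s.erase d : Finset I) : Set I).pi t ×ˢ t d := by
      ext ⟨y, x⟩
      simp only [Set.mem_preimage, Set.mem_pi, Set.mem_prod, Finset.coe_erase, Set.mem_sdiff,
        Finset.mem_coe, Set.mem_singleton_iff]
      constructor
      · intro h
        refine ⟨fun i hi => ?_, ?_⟩
        · simpa [Function.update_of_ne hi.2] using h i hi.1
        · simpa using h d hd
      · rintro ⟨h, hx⟩ i hi
        by_cases hid : i = d
        · subst hid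
          simpa using hx
        · simpa [Function.update_of_ne hid] using h i ⟨hi, hid⟩
    rw [this, Measure.prod_prod, Measure.infinitePi_pi _ (fun i _ => ht i),
      Finset.prod_erase_mul _ _ hd]
  · have : (fun p : (I → X) × X => Function.update p.1 d p.2) ⁻¹' (s : Set I).pi t =
        (s : Set I).pi t ×ˢ Set.univ := by
      ext ⟨y, x⟩
      simp only [Set.mem_preimage, Set.mem_pi, Set.mem_prod, Finset.mem_coe, Set.mem_univ,
        and_true]
      refine forall₂_congr fun i hi => ?_
      have hid : i ≠ d := fun h => hd (h ▸ hi)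
      rw [Function.update_of_ne hid]
    rw [this, Measure.prod_prod, Measure.infinitePi_pi _ (fun i _ => ht i), measure_univ, mul_one]

variable {μ}

/-- Let `Z y c` be obtained by reading `y` at a coordinate `σ c y` and moving the result by a
measure preserving map. If altering `y` at `σ c y` affects neither the choice of this coordinate
and of the map, nor the other outputs that are at most as long as `c`, then `Z` carries the product
measure to the product measure: conditionally on the other outputs involved, a longest output is
distributed according to `μ`. -/
theorem measurePreserving_of_adaptive [Countable I] [DecidableEq I]
    {Z : (I → X) → J → X} (hZ : Measurable Z) (len : J → ℕ) (σ : J → (I → X) → I)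
    (hσ : ∀ c d, MeasurableSet {y | σ c y = d})
    (hσu : ∀ c y x, σ c (Function.update y (σ c y) x) = σ c y)
    (hother : ∀ c b y x, b ≠ c → len b ≤ len c → Z (Function.update y (σ c y) x) b = Z y b)
    (hself : ∀ c y, ∃ ψ : X → X, MeasurePreserving ψ μ μ ∧
      ∀ x, Z (Function.update y (σ c y) x) c = ψ x) :
    MeasurePreserving Z (Measure.infinitePi fun _ : I => μ) (Measure.infinitePi fun _ : J => μ) := by
  classical
  set P := Measure.infinitePi fun _ : I => μ with hP
  refine ⟨hZ, Measure.eq_infinitePi _ fun s t ht => ?_⟩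
  have hpi : ∀ s : Finset J, MeasurableSet ((s : Set J).pi t) := fun s =>
    MeasurableSet.pi s.countable_toSet fun i _ => ht i
  rw [Measure.map_apply hZ (hpi s)]
  induction s using Finset.induction_on_max_value len with
  | empty => simp
  | insert a s has hmax ih =>
    set E : Set (I → X) := Z ⁻¹' (s : Set J).pi t with hE
    have hEm : MeasurableSet E := hZ (hpi s)
    have hsum : ∀ B : Set (I → X), MeasurableSet B → P B = ∑' d, P (B ∩ {y | σ a y = d}) := by
      intro B hB
      rw [← measure_iUnion (fun d d' hdd' => Set.disjoint_left.2
        fun y hy hy' => hdd' (hy.2.symm.trans hy'.2)) (fun d => hB.inter (hσ a d))]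
      congr 1
      ext y
      simp
    have hcond : ∀ d, P (Z ⁻¹' ((insert a s : Finset J) : Set J).pi t ∩ {y | σ a y = d}) =
        μ (t a) * P (E ∩ {y | σ a y = d}) := by
      intro d
      have hBm := (hZ (hpi (insert a s))).inter (hσ a d)
      rw [← (measurePreserving_update μ d).measure_preimage hBm.nullMeasurableSet,
        Measure.prod_apply ((measurePreserving_update μ d).measurable hBm),
        ← lintegral_indicator_const (hEm.inter (hσ a d))]
      refine lintegral_congr fun y => ?_
      by_cases hy : σ a y = d
      · subst hy
        obtain ⟨ψ, hψ, hψx⟩ := hself a y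
        have hset : Prod.mk y ⁻¹' ((fun p : (I → X) × X => Function.update p.1 (σ a y) p.2) ⁻¹'
            (Z ⁻¹' ((insert a s : Finset J) : Set J).pi t ∩ {y' | σ a y' = σ a y})) =
            {x | y ∈ E} ∩ ψ ⁻¹' t a := by
          ext x
          have hs : ∀ b ∈ s, Z (Function.update y (σ a y) x) b = Z y b := fun b hb =>
            hother a b y x (fun h => has (h ▸ hb)) (hmax b hb)
          simp only [hE, Set.mem_preimage, Set.mem_inter_iff, Set.mem_pi, Finset.mem_coe,
            Finset.mem_insert, forall_eq_or_imp, Set.mem_ofPred_eq, hσu, and_true, hψx]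
          rw [and_comm]
          exact and_congr_left fun _ => forall₂_congr fun b hb => by rw [hs b hb]
        rw [hset]
        by_cases hyE : y ∈ E
        · simp [hyE, hψ.measure_preimage (ht a).nullMeasurableSet]
        · simp [hyE]
      · rw [Set.indicator_of_notMem (fun h => hy h.2)]
        refine measure_mono_null (t := ∅) (fun x hx => ?_) measure_empty
        -- restoring the coordinate `d` shows that `d` was already selected by `y`
        have hx2 : σ a (Function.update y d x) = d := hx.2
        have := hσu a (Function.update y d x) (y d)
        rw [hx2] at this
        simp only [Function.update_idem, Function.update_eq_self] at this
        exact hy this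
    rw [Finset.prod_insert has, ← ih, hsum _ (hZ (hpi _)), hsum _ hEm, ← ENNReal.tsum_mul_left]
    exact tsum_congr hcond

end Adaptive

/-! ### Words for cosets of the free product -/

section Words

variable {Γ Λ : Type*} [Group Γ] [Group Λ]

/-- The element `γ₁ λ₁ ⋯ γₙ λₙ` of `Γ * Λ`. -/
def evalWord : List (Γ × Λ) → Monoid.Coprod Γ Λ
  | [] => 1
  | p :: w => Monoid.Coprod.inl p.1 * (freeFactor Γ Λ p.2 * evalWord w)

/-- Every coset `Λ g` is represented by a word. The letters may be trivial: reduced forms are not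
needed. -/
theorem exists_eq_mul_evalWord (g : Monoid.Coprod Γ Λ) :
    ∃ (l : Λ) (w : List (Γ × Λ)), g = freeFactor Γ Λ l * evalWord w := by
  have key : ∀ g h : Monoid.Coprod Γ Λ,
      (∃ (l : Λ) (w : List (Γ × Λ)), h = freeFactor Γ Λ l * evalWord w) →
      ∃ (l : Λ) (w : List (Γ × Λ)), g * h = freeFactor Γ Λ l * evalWord w := by
    intro g
    induction g using Monoid.Coprod.induction_on with
    | inl γ =>
      rintro _ ⟨l, w, rfl⟩
      exact ⟨1, (γ, l) :: w, by simp [evalWord]⟩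
    | inr l' =>
      rintro _ ⟨l, w, rfl⟩
      exact ⟨l' * l, w, by simp [freeFactor, mul_assoc]⟩
    | mul x y hx hy =>
      intro h hh
      rw [mul_assoc]
      exact hx _ (hy _ hh)
  simpa using key g 1 ⟨1, [], by simp [evalWord]⟩

theorem exists_minimal_word (c : RightCosets (freeFactor Γ Λ)) :
    ∃ w : List (Γ × Λ), coset (freeFactor Γ Λ) (evalWord w) = c ∧
      ∀ w' : List (Γ × Λ), coset (freeFactor Γ Λ) (evalWord w') = c → w.length ≤ w'.length := by
  have hne : {w : List (Γ × Λ) | coset (freeFactor Γ Λ) (evalWord w) = c}.Nonempty := by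
    obtain ⟨g, rfl⟩ := exists_coset_eq c
    obtain ⟨l, w, rfl⟩ := exists_eq_mul_evalWord g
    exact ⟨w, coset_eq_iff.2 ⟨l, rfl⟩⟩
  exact ⟨_, Function.argminOn_mem List.length _ hne,
    fun w' hw' => Function.argminOn_le List.length _ hw'⟩

/-- A shortest word representing a coset. -/
noncomputable def cosetWord (c : RightCosets (freeFactor Γ Λ)) : List (Γ × Λ) :=
  (exists_minimal_word c).choose

theorem coset_evalWord_cosetWord (c : RightCosets (freeFactor Γ Λ)) :
    coset (freeFactor Γ Λ) (evalWord (cosetWord c)) = c :=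
  (exists_minimal_word c).choose_spec.1

theorem length_cosetWord_le (w : List (Γ × Λ)) :
    (cosetWord (coset (freeFactor Γ Λ) (evalWord w))).length ≤ w.length :=
  (exists_minimal_word _).choose_spec.2 w rfl

theorem countable_coprod [Countable Γ] [Countable Λ] : Countable (Monoid.Coprod Γ Λ) :=
  have : Countable (FreeMonoid (Γ ⊕ Λ)) := inferInstanceAs (Countable (List (Γ ⊕ Λ)))
  Monoid.Coprod.mk_surjective.countable

end Words

/-! ### The map between the co-induced spaces preserves the product measures -/

namespace SameOrbits

variable {Γ Λ₀ Λ₁ K X : Type*} [Group Γ] [Group Λ₀] [Group Λ₁] [Group K]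
  {α₀ : Λ₀ × K →* Equiv.Perm X} {α₁ : Λ₁ × K →* Equiv.Perm X} (M : SameOrbits α₀ α₁)
  (r₀ : EquivariantMap (freeFactor Γ Λ₀)) (r₁ : EquivariantMap (freeFactor Γ Λ₁))

theorem rootAlong_eq (y : RightCosets (freeFactor Γ Λ₀) → X) (g : Monoid.Coprod Γ Λ₀ × K) :
    rootAlong r₀ α₀ y g = α₀ (r₀.toFun g.1, g.2) (y (coset _ g.1)) :=
  root_coinducedProdAction r₀ α₀ g.1 g.2 y

theorem theta_coset (y : RightCosets (freeFactor Γ Λ₀) → X) (g : Monoid.Coprod Γ Λ₁) :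
    M.theta r₀ r₁ y (coset _ g) =
      α₁ ((r₁.toFun g)⁻¹, 1) (rootAlong r₀ α₀ y (M.label r₀ y (g, 1))) := by
  rw [theta, toCoinduced_coset (M.equivariantAlong_rewire _), rootAlong, smul_label]

theorem label_evalWord_cons (y : RightCosets (freeFactor Γ Λ₀) → X) (p : Γ × Λ₁)
    (w : List (Γ × Λ₁)) :
    M.label r₀ y (evalWord (p :: w), 1) = (Monoid.Coprod.inl p.1, 1) *
      ((freeFactor Γ Λ₀ (M.cocycle (p.2, 1) (rootAlong r₀ α₀ y (M.label r₀ y (evalWord w, 1)))).1,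
        (M.cocycle (p.2, 1) (rootAlong r₀ α₀ y (M.label r₀ y (evalWord w, 1)))).2) *
        M.label r₀ y (evalWord w, 1)) := by
  have : ((evalWord (p :: w), 1) : Monoid.Coprod Γ Λ₁ × K) =
      (Monoid.Coprod.inl p.1, 1) * ((freeFactor Γ Λ₁ p.2, 1) * (evalWord w, 1)) := by
    simp [evalWord]
  rw [this, label_inl_mul, label_freeFactor_mul]

/-- The label of a word depends only on the coordinates read along its proper suffixes. -/
theorem label_evalWord_congr {y y' : RightCosets (freeFactor Γ Λ₀) → X} (w : List (Γ × Λ₁))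
    (h : ∀ s, s <:+ w → s.length < w.length →
      y' (coset _ (M.label r₀ y (evalWord s, 1)).1) = y (coset _ (M.label r₀ y (evalWord s, 1)).1)) :
    M.label r₀ y' (evalWord w, 1) = M.label r₀ y (evalWord w, 1) := by
  induction w with
  | nil => exact (M.label_one r₀ y').trans (M.label_one r₀ y).symm
  | cons p w ih =>
    have ih' := ih fun s hs hl => h s (hs.trans (List.suffix_cons p w)) (by
      rw [List.length_cons]; omega)
    rw [label_evalWord_cons, label_evalWord_cons, ih', rootAlong_eq, rootAlong_eq,
      h w (List.suffix_cons p w) (by simp)]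

section Measurable

variable [Countable Γ] [Countable Λ₀] [MeasurableSpace Λ₀] [DiscreteMeasurableSpace Λ₀]
  [TopologicalSpace K] [IsTopologicalGroup K] [T2Space K] [CompactSpace K]
  [SecondCountableTopology K] [MeasurableSpace K] [BorelSpace K]
  [MeasurableSpace X] [StandardBorelSpace X]

omit [IsTopologicalGroup K] in
theorem measurable_cocycle (hα₀ : Measurable fun p : (Λ₀ × K) × X => α₀ p.1 p.2)
    (hα₁ : ∀ h, Measurable fun x => α₁ h x) (h : Λ₁ × K) : Measurable (M.cocycle h) := by
  have := polishSpace_of_compact K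
  refine measurable_of_measurableSet_graph _ ?_
  have : {p : X × (Λ₀ × K) | p.2 = M.cocycle h p.1} =
      {p : X × (Λ₀ × K) | α₀ p.2 p.1 = α₁ h p.1} := by
    ext p
    exact ⟨fun hp => by rw [Set.mem_ofPred_eq, show p.2 = _ from hp, M.cocycle_spec],
      fun hp => (M.cocycle_eq hp).symm⟩
  rw [this]
  exact measurableSet_eq_fun (hα₀.comp measurable_swap) ((hα₁ h).comp measurable_fst)

/-- The countable group `Γ * Λ₀` carries the discrete σ-algebra. -/
local instance instMeasurableSpaceCoprod : MeasurableSpace (Monoid.Coprod Γ Λ₀) := ⊤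

local instance instDiscreteMeasurableSpaceCoprod :
    DiscreteMeasurableSpace (Monoid.Coprod Γ Λ₀) := ⟨fun _ => trivial⟩

omit [DiscreteMeasurableSpace Λ₀] [TopologicalSpace K] [IsTopologicalGroup K] [T2Space K]
  [CompactSpace K] [SecondCountableTopology K] [BorelSpace K] [StandardBorelSpace X] in
theorem measurable_rootAlong (hα₀ : Measurable fun p : (Λ₀ × K) × X => α₀ p.1 p.2)
    {L : (RightCosets (freeFactor Γ Λ₀) → X) → Monoid.Coprod Γ Λ₀ × K} (hL : Measurable L) :
    Measurable fun y => rootAlong r₀ α₀ y (L y) := by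
  have := countable_coprod (Γ := Γ) (Λ := Λ₀)
  simp only [rootAlong_eq]
  refine hα₀.comp (Measurable.prodMk (Measurable.prodMk ?_ hL.snd) ?_)
  · exact measurable_from_top.comp hL.fst
  · have : Measurable fun p : (RightCosets (freeFactor Γ Λ₀) → X) × Monoid.Coprod Γ Λ₀ =>
        p.1 (coset _ p.2) :=
      measurable_from_prod_countable_left fun g => measurable_pi_apply (coset _ g)
    exact this.comp (measurable_id.prodMk hL.fst)

theorem measurable_label (hα₀ : Measurable fun p : (Λ₀ × K) × X => α₀ p.1 p.2)
    (hα₁ : ∀ h, Measurable fun x => α₁ h x) (w : List (Γ × Λ₁)) :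
    Measurable fun y => M.label r₀ y (evalWord w, 1) := by
  have := countable_coprod (Γ := Γ) (Λ := Λ₀)
  have hcop : MeasurableMul₂ (Monoid.Coprod Γ Λ₀) := ⟨Measurable.of_discrete⟩
  induction w with
  | nil =>
    have : (fun y => M.label r₀ y (evalWord ([] : List (Γ × Λ₁)), 1)) = fun _ => 1 :=
      funext fun y => M.label_one r₀ y
    rw [this]
    exact measurable_const
  | cons p w ih =>
    simp only [label_evalWord_cons]
    have hc := (M.measurable_cocycle hα₀ hα₁ (p.2, 1)).comp (measurable_rootAlong r₀ hα₀ ih)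
    have hmul : ∀ {f g : (RightCosets (freeFactor Γ Λ₀) → X) → Monoid.Coprod Γ Λ₀ × K},
        Measurable f → Measurable g → Measurable fun y => f y * g y := fun hf hg =>
      (hf.fst.mul hg.fst).prodMk (hf.snd.mul hg.snd)
    refine hmul measurable_const (hmul (Measurable.prodMk ?_ hc.snd) ih)
    exact Measurable.of_discrete.comp hc.fst

theorem measurable_theta (hα₀ : Measurable fun p : (Λ₀ × K) × X => α₀ p.1 p.2)
    (hα₁ : ∀ h, Measurable fun x => α₁ h x) : Measurable (M.theta r₀ r₁) := by
  refine measurable_pi_iff.2 fun c => ?_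
  rw [← coset_evalWord_cosetWord c]
  simp only [theta_coset]
  exact (hα₁ _).comp (measurable_rootAlong r₀ hα₀ (M.measurable_label r₀ hα₀ hα₁ _))

theorem measurePreserving_theta {μ : Measure X} [IsProbabilityMeasure μ]
    (hα₀ : IsPMP α₀ μ) (hα₁ : ∀ h, MeasurePreserving (fun x => α₁ h x) μ μ) :
    MeasurePreserving (M.theta r₀ r₁) (coinducedMeasure (freeFactor Γ Λ₀) μ)
      (coinducedMeasure (freeFactor Γ Λ₁) μ) := by
  classical
  have := countable_coprod (Γ := Γ) (Λ := Λ₀)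
  have hmeas := fun h => (hα₁ h).measurable
  have : Countable (RightCosets (freeFactor Γ Λ₀)) :=
    (Quotient.mk_surjective (s := QuotientGroup.rightRel (freeFactor Γ Λ₀).range)).countable
  -- the coordinate that the output at `c` reads
  let σ : RightCosets (freeFactor Γ Λ₁) → (RightCosets (freeFactor Γ Λ₀) → X) →
      RightCosets (freeFactor Γ Λ₀) := fun c y =>
    coset _ (M.label r₀ y (evalWord (cosetWord c), 1)).1
  have hlabel : ∀ c y x (w : List (Γ × Λ₁)),
      (∀ s, s <:+ w → s.length < w.length → s.length < (cosetWord c).length) →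
      M.label r₀ (Function.update y (σ c y) x) (evalWord w, 1) = M.label r₀ y (evalWord w, 1) := by
    intro c y x w hw
    refine M.label_evalWord_congr r₀ w fun s hs hl => Function.update_of_ne (fun hsc => ?_) _ _
    have h1 := M.coset_eq_of_coset_label_eq r₀ r₁ y hsc
    rw [coset_evalWord_cosetWord] at h1
    have h2 := length_cosetWord_le s
    rw [h1] at h2
    exact absurd (hw s hs hl) (not_lt.2 h2)
  have hself : ∀ c y x, M.label r₀ (Function.update y (σ c y) x) (evalWord (cosetWord c), 1) =
      M.label r₀ y (evalWord (cosetWord c), 1) := fun c y x =>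
    hlabel c y x _ fun s _ h => h
  refine measurePreserving_of_adaptive (M.measurable_theta r₀ r₁ hα₀.measurable hmeas)
    (fun c => (cosetWord c).length) σ (fun c d => ?_) (fun c y x => ?_) (fun c b y x hbc hle => ?_)
    (fun c y => ?_)
  · exact (M.measurable_label r₀ hα₀.measurable hmeas (cosetWord c)).fst
      (t := {g | coset (freeFactor Γ Λ₀) g = d}) (MeasurableSet.of_discrete)
  · simp only [σ]
    rw [hself c y x]
  · rw [← coset_evalWord_cosetWord b, theta_coset, theta_coset,
      hlabel c y x _ fun s _ h => lt_of_lt_of_le h hle, rootAlong_eq, rootAlong_eq,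
      Function.update_of_ne]
    intro h
    have := M.coset_eq_of_coset_label_eq r₀ r₁ y h
    rw [coset_evalWord_cosetWord, coset_evalWord_cosetWord] at this
    exact hbc this
  · refine ⟨_, (hα₁ ((r₁.toFun (evalWord (cosetWord c)))⁻¹, 1)).comp
      (hα₀.measurePreserving (r₀.toFun (M.label r₀ y (evalWord (cosetWord c), 1)).1,
        (M.label r₀ y (evalWord (cosetWord c), 1)).2)), fun x => ?_⟩
    conv_lhs => rw [← coset_evalWord_cosetWord c, theta_coset, coset_evalWord_cosetWord, hself c y x,
      rootAlong_eq]
    simp only [σ, Function.update_self, Function.comp_apply]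

end Measurable

end SameOrbits

/-! ### Descent to the spaces of `K`-orbits -/

section Descent

variable {H K X : Type*} [Group H] [Group K]

/-- The factor map `X → X / K`. -/
abbrev toOrbit (α : H × K →* Equiv.Perm X) (x : X) : OrbitSpace α := Quotient.mk (orbitSetoid α) x

theorem toOrbit_eq_iff {α : H × K →* Equiv.Perm X} {x y : X} :
    toOrbit α x = toOrbit α y ↔ ∃ k, α (1, k) x = y := Quotient.eq

theorem quotientAction_toOrbit (α : H × K →* Equiv.Perm X) (h : H) (x : X) :
    quotientAction α h (toOrbit α x) = toOrbit α (α (h, 1) x) := rfl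

theorem toOrbit_smul (α : H × K →* Equiv.Perm X) (h : H) (k : K) (x : X) :
    toOrbit α (α (h, k) x) = quotientAction α h (toOrbit α x) := by
  rw [quotientAction_toOrbit, eq_comm, toOrbit_eq_iff]
  exact ⟨k, by rw [← Equiv.Perm.mul_apply, ← map_mul]; simp⟩

theorem toOrbit_preimage_image {α : H × K →* Equiv.Perm X} {S : Set X}
    (hS : ∀ k, ∀ x ∈ S, α (1, k) x ∈ S) : toOrbit α ⁻¹' (toOrbit α '' S) = S := by
  ext x
  constructor
  · rintro ⟨y, hy, hyx⟩
    obtain ⟨k, rfl⟩ := toOrbit_eq_iff.1 hyx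
    exact hS k y hy
  · exact fun hx => ⟨x, hx, rfl⟩

variable [MeasurableSpace X]

theorem measurable_toOrbit (α : H × K →* Equiv.Perm X) : Measurable (toOrbit α) :=
  measurable_quotient_mk''

theorem measurableSet_toOrbit_image {α : H × K →* Equiv.Perm X} {S : Set X} (hS : MeasurableSet S)
    (hSK : ∀ k, ∀ x ∈ S, α (1, k) x ∈ S) : MeasurableSet (toOrbit α '' S) := by
  rw [measurableSet_quotient]
  change MeasurableSet (toOrbit α ⁻¹' (toOrbit α '' S))
  rwa [toOrbit_preimage_image hSK]

theorem quotientMeasure_apply (α : H × K →* Equiv.Perm X) (μ : Measure X) {T : Set (OrbitSpace α)}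
    (hT : MeasurableSet T) : quotientMeasure α μ T = μ (toOrbit α ⁻¹' T) :=
  Measure.map_apply (measurable_toOrbit α) hT

/-- An equivariant pair of maps `j₀`, `j₁` with `j₀` injective gives a map of the spaces of
`K`-orbits. Its measurability on the image of `j₀` is stated through preimages, which are images of
measurable sets of `W`. -/
theorem exists_descended_map {H₀ H₁ K W Y₀ Y₁ : Type*} [Group H₀] [Group H₁] [Group K]
    [MeasurableSpace W] [StandardBorelSpace W] [Nonempty W] [MeasurableSpace Y₀]
    [StandardBorelSpace Y₀] [MeasurableSpace Y₁] {A₀ : H₀ × K →* Equiv.Perm Y₀}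
    {A₁ : H₁ × K →* Equiv.Perm Y₁} (κ : K →* Equiv.Perm W) {j₀ : W → Y₀} {j₁ : W → Y₁}
    (hj₀ : Measurable j₀) (hj₁ : Measurable j₁) (inj₀ : Function.Injective j₀)
    (eq₀ : ∀ k w, j₀ (κ k w) = A₀ (1, k) (j₀ w)) (eq₁ : ∀ k w, j₁ (κ k w) = A₁ (1, k) (j₁ w)) :
    ∃ F : OrbitSpace A₀ → OrbitSpace A₁, (∀ w, F (toOrbit A₀ (j₀ w)) = toOrbit A₁ (j₁ w)) ∧
      ∀ T, MeasurableSet T →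
        MeasurableSet ((fun w => toOrbit A₀ (j₀ w)) '' {w | toOrbit A₁ (j₁ w) ∈ T}) := by
  classical
  have orbit₁ : ∀ k w, toOrbit A₁ (j₁ (κ k w)) = toOrbit A₁ (j₁ w) := fun k w =>
    (toOrbit_eq_iff.2 ⟨k, (eq₁ k w).symm⟩).symm
  have hF : ∀ w w', toOrbit A₀ (j₀ w) = toOrbit A₀ (j₀ w') →
      toOrbit A₁ (j₁ w) = toOrbit A₁ (j₁ w') := by
    intro w w' h
    obtain ⟨k, hk⟩ := toOrbit_eq_iff.1 h
    rw [← inj₀ ((eq₀ k w).trans hk), orbit₁]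
  refine ⟨fun q => if h : ∃ w, toOrbit A₀ (j₀ w) = q then toOrbit A₁ (j₁ h.choose)
    else toOrbit A₁ (j₁ (Classical.arbitrary W)), fun w => ?_, fun T hT => ?_⟩
  · have h : ∃ w', toOrbit A₀ (j₀ w') = toOrbit A₀ (j₀ w) := ⟨w, rfl⟩
    simp only [h, dif_pos]
    exact hF _ _ h.choose_spec
  · have hS : MeasurableSet {w | toOrbit A₁ (j₁ w) ∈ T} := ((measurable_toOrbit A₁).comp hj₁) hT
    rw [← Set.image_image (toOrbit A₀) j₀]
    refine measurableSet_toOrbit_image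
      ((hj₀.measurableEmbedding inj₀).measurableSet_image.2 hS) ?_
    rintro k _ ⟨w, hw, rfl⟩
    exact ⟨κ k w, by rwa [Set.mem_ofPred_eq, orbit₁], eq₀ k w⟩

/-- Two equivariant models `j₀`, `j₁` of a space `W` with an action of `K` induce an isomorphism of
the spaces of `K`-orbits. -/
theorem exists_probIso_quotient {H₀ H₁ K W Y₀ Y₁ : Type*} [Group H₀] [Group H₁] [Group K]
    [MeasurableSpace W] [StandardBorelSpace W] [MeasurableSpace Y₀] [StandardBorelSpace Y₀]
    [MeasurableSpace Y₁] [StandardBorelSpace Y₁] {A₀ : H₀ × K →* Equiv.Perm Y₀}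
    {A₁ : H₁ × K →* Equiv.Perm Y₁} (κ : K →* Equiv.Perm W) {ν : Measure W} [IsProbabilityMeasure ν]
    {η₀ : Measure Y₀} {η₁ : Measure Y₁} {j₀ : W → Y₀} {j₁ : W → Y₁}
    (hj₀ : MeasurePreserving j₀ ν η₀) (hj₁ : MeasurePreserving j₁ ν η₁)
    (inj₀ : Function.Injective j₀) (inj₁ : Function.Injective j₁)
    (eq₀ : ∀ k w, j₀ (κ k w) = A₀ (1, k) (j₀ w)) (eq₁ : ∀ k w, j₁ (κ k w) = A₁ (1, k) (j₁ w)) :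
    ∃ Δ : ProbIso (quotientMeasure A₀ η₀) (quotientMeasure A₁ η₁),
      (∀ w, Δ.toFun (toOrbit A₀ (j₀ w)) = toOrbit A₁ (j₁ w)) ∧
        ∀ᵐ q ∂(quotientMeasure A₀ η₀), ∃ w, toOrbit A₀ (j₀ w) = q := by
  have : Nonempty W := nonempty_of_isProbabilityMeasure ν
  obtain ⟨F, hF, hFm⟩ := exists_descended_map κ hj₀.measurable hj₁.measurable inj₀ eq₀ eq₁
  obtain ⟨E, hE, hEm⟩ := exists_descended_map κ hj₁.measurable hj₀.measurable inj₁ eq₁ eq₀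
  have hq₀ : MeasurePreserving (fun w => toOrbit A₀ (j₀ w)) ν (quotientMeasure A₀ η₀) :=
    (MeasurePreserving.mk (measurable_toOrbit A₀) rfl).comp hj₀
  have hq₁ : MeasurePreserving (fun w => toOrbit A₁ (j₁ w)) ν (quotientMeasure A₁ η₁) :=
    (MeasurePreserving.mk (measurable_toOrbit A₁) rfl).comp hj₁
  have hs₀ : MeasurableSet (Set.range fun w => toOrbit A₀ (j₀ w)) := by
    simpa using hFm Set.univ MeasurableSet.univ
  have hs₁ : MeasurableSet (Set.range fun w => toOrbit A₁ (j₁ w)) := by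
    simpa using hEm Set.univ MeasurableSet.univ
  have hae₀ : ∀ᵐ q ∂(quotientMeasure A₀ η₀), q ∈ Set.range fun w => toOrbit A₀ (j₀ w) := by
    rw [← hq₀.map_eq]
    exact (ae_map_iff (p := fun q => q ∈ Set.range fun w => toOrbit A₀ (j₀ w))
      hq₀.measurable.aemeasurable hs₀).2 (ae_of_all _ fun w => ⟨w, rfl⟩)
  have hae₁ : ∀ᵐ q ∂(quotientMeasure A₁ η₁), q ∈ Set.range fun w => toOrbit A₁ (j₁ w) := by
    rw [← hq₁.map_eq]
    exact (ae_map_iff (p := fun q => q ∈ Set.range fun w => toOrbit A₁ (j₁ w))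
      hq₁.measurable.aemeasurable hs₁).2 (ae_of_all _ fun w => ⟨w, rfl⟩)
  have hpre : ∀ T : Set (OrbitSpace A₁), (Set.range fun w => toOrbit A₀ (j₀ w)) ∩ F ⁻¹' T =
      (fun w => toOrbit A₀ (j₀ w)) '' {w | toOrbit A₁ (j₁ w) ∈ T} := by
    intro T
    ext q
    constructor
    · rintro ⟨⟨w, rfl⟩, hw⟩
      exact ⟨w, by rwa [Set.mem_preimage, hF] at hw, rfl⟩
    · rintro ⟨w, hw, rfl⟩
      exact ⟨⟨w, rfl⟩, by rwa [Set.mem_preimage, hF]⟩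
  refine ⟨{ toFun := F
            invFun := E
            source := Set.range fun w => toOrbit A₀ (j₀ w)
            target := Set.range fun w => toOrbit A₁ (j₁ w)
            map_source' := ?_
            map_target' := ?_
            left_inv' := ?_
            right_inv' := ?_
            measurableSet_source := hs₀
            measurableSet_target := hs₁
            ae_mem_source := hae₀
            ae_mem_target := hae₁
            measurable_toFun := fun T hT => ?_
            measurable_invFun := fun T hT => ?_
            measure_preimage := fun T hT => ?_ }, hF, hae₀⟩
  · rintro _ ⟨w, rfl⟩
    exact ⟨w, (hF w).symm⟩
  · rintro _ ⟨w, rfl⟩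
    exact ⟨w, (hE w).symm⟩
  · rintro _ ⟨w, rfl⟩
    simp only [hF, hE]
  · rintro _ ⟨w, rfl⟩
    simp only [hF, hE]
  · convert measurable_subtype_coe (hFm T hT) using 1
    ext ⟨q, w, rfl⟩
    simp only [Set.mem_preimage, ← hpre, hF]
    simp [hF]
  · convert measurable_subtype_coe (hEm T hT) using 1
    ext ⟨q, w, rfl⟩
    simp only [Set.mem_preimage, hE]
    constructor
    · exact fun h => ⟨w, h, rfl⟩
    · rintro ⟨w', hw', h⟩
      have h2 := congrArg E h
      simp only [hE] at h2
      rwa [← h2]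
  · simp only [hpre]
    rw [← hq₀.measure_preimage (hFm T hT).nullMeasurableSet,
      ← hq₁.measure_preimage hT.nullMeasurableSet]
    congr 1
    ext w
    constructor
    · rintro ⟨w', hw', h⟩
      have h2 := congrArg F h
      simp only [hF] at h2
      rwa [Set.mem_preimage, ← h2]
    · exact fun hw => ⟨w, hw, rfl⟩

end Descent

/-! ### A common model of two actions with isomorphic spaces of `K`-orbits -/

/-- The pullback of an action along an injective map with invariant range. -/
theorem exists_action_of_injective {G W X : Type*} [Group G] (α : G →* Equiv.Perm X) {j : W → X}
    (hj : Function.Injective j) (hr : ∀ g w, ∃ w', j w' = α g (j w)) :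
    ∃ β : G →* Equiv.Perm W, ∀ g w, j (β g w) = α g (j w) := by
  choose f hf using hr
  let _ : MulAction G W :=
    { smul := f
      one_smul := fun w => hj (by
        change j (f 1 w) = j w
        rw [hf, map_one]
        rfl)
      mul_smul := fun g h w => hj (by
        change j (f (g * h) w) = j (f g (f h w))
        rw [hf, hf, hf, map_mul]
        rfl) }
  exact ⟨MulAction.toPermHom G W, hf⟩

theorem IsPMP.of_measurableEmbedding {G W X : Type*} [Group G] [MeasurableSpace G]
    [MeasurableSpace W] [MeasurableSpace X] {α : G →* Equiv.Perm X} {β : G →* Equiv.Perm W}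
    {μ : Measure X} {ν : Measure W} {j : W → X} (hα : IsPMP α μ) (hj : MeasurableEmbedding j)
    (hjm : MeasurePreserving j ν μ) (heq : ∀ g w, j (β g w) = α g (j w)) : IsPMP β ν := by
  have hβ : Measurable fun p : G × W => β p.1 p.2 := by
    rw [← hj.measurable_comp_iff]
    have : (j ∘ fun p : G × W => β p.1 p.2) = fun p : G × W => α p.1 (j p.2) :=
      funext fun p => heq p.1 p.2
    rw [this]
    exact hα.measurable.comp (measurable_fst.prodMk (hj.measurable.comp measurable_snd))
  refine ⟨hβ, fun g => ?_⟩
  have hg : Measurable fun w => β g w := hβ.comp (measurable_const.prodMk measurable_id)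
  refine ⟨hg, Measure.ext fun B hB => ?_⟩
  have hjB := hj.measurableSet_image.2 hB
  have h1 : (fun w => β g w) ⁻¹' B = j ⁻¹' ((fun x => α g x) ⁻¹' (j '' B)) := by
    ext w
    simp only [Set.mem_preimage, ← heq, hj.injective.mem_set_image]
  rw [Measure.map_apply hg hB, h1, hjm.measure_preimage
      ((hα.measurePreserving g).measurable hjB).nullMeasurableSet,
    (hα.measurePreserving g).measure_preimage hjB.nullMeasurableSet,
    ← hjm.measure_preimage hjB.nullMeasurableSet, hj.injective.preimage_image]

theorem free_smul {G X : Type*} [Group G] (α : G →* Equiv.Perm X) (h : G) (x : X)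
    (hx : ∀ g, α g x = x → g = 1) (g : G) (hg : α g (α h x) = α h x) : g = 1 := by
  have h1 := hx (h⁻¹ * g * h) (by
    rw [map_mul, map_mul, Equiv.Perm.mul_apply, Equiv.Perm.mul_apply, hg, ← Equiv.Perm.mul_apply,
      ← map_mul]
    simp)
  rw [← conj_eq_one_iff (a := h⁻¹)]
  simpa using h1

theorem ProbIso.measurableSet_inter_preimage {X Y : Type*} [MeasurableSpace X] [MeasurableSpace Y]
    {μ : Measure X} {ν : Measure Y} (Δ : ProbIso μ ν) {T : Set Y} (hT : MeasurableSet T) :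
    MeasurableSet (Δ.source ∩ Δ.toFun ⁻¹' T) := by
  have := Δ.measurableSet_source.subtype_image (Δ.measurable_toFun hT)
  convert this using 1
  ext x
  simp [and_comm]

/-- Two essentially free actions whose spaces of `K`-orbits are identified by `Δ`, compatibly with
the orbits, are up to null sets two free actions on one space. The map `j₁` into the second space
lifts `Δ`; it exists because free actions of compact groups have measurable sections. -/
theorem exists_common_model {Λ₀ Λ₁ K X₀ X₁ : Type*}
    [Group Λ₀] [Countable Λ₀] [MeasurableSpace Λ₀] [DiscreteMeasurableSpace Λ₀]
    [Group Λ₁] [Countable Λ₁] [MeasurableSpace Λ₁] [DiscreteMeasurableSpace Λ₁]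
    [Group K] [TopologicalSpace K] [IsTopologicalGroup K] [T2Space K] [CompactSpace K]
    [SecondCountableTopology K] [MeasurableSpace K] [BorelSpace K]
    [MeasurableSpace X₀] [StandardBorelSpace X₀] {μ₀ : Measure X₀} [IsProbabilityMeasure μ₀]
    [MeasurableSpace X₁] [StandardBorelSpace X₁] {μ₁ : Measure X₁} [IsProbabilityMeasure μ₁]
    {α₀ : Λ₀ × K →* Equiv.Perm X₀} (hα₀ : IsPMP α₀ μ₀) (hfree₀ : IsEssentiallyFree α₀ μ₀)
    {α₁ : Λ₁ × K →* Equiv.Perm X₁} (hα₁ : IsPMP α₁ μ₁) (hfree₁ : IsEssentiallyFree α₁ μ₁)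
    (Δ : ProbIso (quotientMeasure α₀ μ₀) (quotientMeasure α₁ μ₁)) {Q : OrbitSpace α₀ → Prop}
    (hQ : ∀ᵐ q ∂(quotientMeasure α₀ μ₀), Q q)
    (hQorb : ∀ q, Q q →
      Δ.toFun '' orbit (quotientAction α₀) q = orbit (quotientAction α₁) (Δ.toFun q)) :
    ∃ (A : Set X₀) (ν : Measure A) (j : A → X₁) (β₀ : Λ₀ × K →* Equiv.Perm A)
      (β₁ : Λ₁ × K →* Equiv.Perm A), MeasurableSet A ∧ IsProbabilityMeasure ν ∧
      MeasurePreserving Subtype.val ν μ₀ ∧ MeasurePreserving j ν μ₁ ∧ Function.Injective j ∧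
      (∀ g x, (β₀ g x : X₀) = α₀ g x) ∧ (∀ g x, j (β₁ g x) = α₁ g (j x)) ∧
      SameOrbits β₀ β₁ ∧ ∀ x : A, Q (toOrbit α₀ x) ∧
        toOrbit α₁ (j x) = Δ.toFun (toOrbit α₀ x) := by
  have hq₀ : MeasurePreserving (toOrbit α₀) μ₀ (quotientMeasure α₀ μ₀) :=
    MeasurePreserving.mk (measurable_toOrbit α₀) rfl
  have : IsProbabilityMeasure (quotientMeasure α₀ μ₀) :=
    Measure.isProbabilityMeasure_map hq₀.measurable.aemeasurable
  have hK₀ : Measurable fun p : K × X₀ => (α₀.comp (MonoidHom.inr Λ₀ K)) p.1 p.2 :=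
    hα₀.measurable.comp ((measurable_const.prodMk measurable_fst).prodMk measurable_snd)
  have hK₁ : Measurable fun p : K × X₁ => (α₁.comp (MonoidHom.inr Λ₁ K)) p.1 p.2 :=
    hα₁.measurable.comp ((measurable_const.prodMk measurable_fst).prodMk measurable_snd)
  -- the free part of the second space
  obtain ⟨A₁, hA₁m, hA₁ae, hA₁inv, hA₁free⟩ := exists_invariant_conull hα₁ hfree₁
    (fun h x hx g => free_smul α₁ h x hx g)
  have hT₁ := measurableSet_toOrbit_image hA₁m fun k => hA₁inv (1, k)
  have hT₁ae : ∀ᵐ q ∂(quotientMeasure α₀ μ₀),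
      q ∈ Δ.source ∩ Δ.toFun ⁻¹' (toOrbit α₁ '' A₁) := by
    refine (mem_ae_iff_prob_eq_one₀
      (Δ.measurableSet_inter_preimage hT₁).nullMeasurableSet).2
      ((Δ.measure_preimage _ hT₁).trans ?_)
    rw [quotientMeasure_apply _ _ hT₁, toOrbit_preimage_image fun k => hA₁inv (1, k)]
    exact (mem_ae_iff_prob_eq_one₀ hA₁m.nullMeasurableSet).1 hA₁ae
  -- the good part of the first space
  obtain ⟨A, hAm, hAae, hAinv, hA⟩ := exists_invariant_conull hα₀
    (P := fun x => (∀ g, α₀ g x = x → g = 1) ∧ ∀ h, Q (toOrbit α₀ (α₀ (h, 1) x)) ∧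
      toOrbit α₀ (α₀ (h, 1) x) ∈ Δ.source ∩ Δ.toFun ⁻¹' (toOrbit α₁ '' A₁))
    (hfree₀.and (ae_all_iff.2 fun h => (hα₀.measurePreserving (h, 1)).quasiMeasurePreserving.ae
      (hq₀.quasiMeasurePreserving.ae (hQ.and hT₁ae))))
    (fun ⟨l, k⟩ x hx => ⟨free_smul α₀ (l, k) x hx.1, fun h => by
      have : toOrbit α₀ (α₀ (h, 1) (α₀ (l, k) x)) = toOrbit α₀ (α₀ (h * l, 1) x) := by
        rw [← Equiv.Perm.mul_apply, ← map_mul, Prod.mk_mul_mk, toOrbit_smul, toOrbit_smul]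
      rw [this]
      exact hx.2 (h * l)⟩)
  have hA1 : ∀ x ∈ A, Q (toOrbit α₀ x) ∧
      toOrbit α₀ x ∈ Δ.source ∩ Δ.toFun ⁻¹' (toOrbit α₁ '' A₁) := by
    intro x hx
    have := (hA x hx).2 1
    rwa [← Prod.one_eq_mk, map_one] at this
  -- equivariant maps to `K`
  obtain ⟨c₀, hc₀m, hc₀⟩ := exists_measurable_equivariantOn _ hK₀ hAm
    (fun k => hAinv (1, k)) (fun x hx k hk => congrArg Prod.snd ((hA x hx).1 (1, k) hk))
  obtain ⟨c₁, hc₁m, hc₁⟩ := exists_measurable_equivariantOn _ hK₁ hA₁m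
    (fun k => hA₁inv (1, k)) (fun x hx k hk => congrArg Prod.snd (hA₁free x hx (1, k) hk))
  simp only [MonoidHom.comp_apply, MonoidHom.inr_apply] at hc₀ hc₁
  obtain ⟨D, hD⟩ : ∃ D : X₁ → X₁, ∀ z, D z = α₁ (1, (c₁ z)⁻¹) z := ⟨_, fun _ => rfl⟩
  have hDm : Measurable D := by
    rw [funext hD]
    exact hα₁.measurable.comp ((measurable_const.prodMk hc₁m.inv).prodMk measurable_id)
  have hDK : ∀ z ∈ A₁, ∀ z', toOrbit α₁ z = toOrbit α₁ z' → D z = D z' := by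
    intro z hz z' h
    obtain ⟨k, rfl⟩ := toOrbit_eq_iff.1 h
    rw [hD, hD, hc₁ z hz, ← Equiv.Perm.mul_apply, ← map_mul]
    simp
  have hsec : ∀ x : A, ∃ z ∈ A₁, toOrbit α₁ z = Δ.toFun (toOrbit α₀ x) := fun x =>
    (hA1 x x.2).2.2
  choose s hsA hs using hsec
  obtain ⟨j, hjdef⟩ : ∃ j : A → X₁, ∀ x : A, j x = α₁ (1, c₀ x) (D (s x)) := ⟨_, fun _ => rfl⟩
  have hDs : ∀ x x' : A, toOrbit α₀ (x : X₀) = toOrbit α₀ (x' : X₀) → D (s x) = D (s x') :=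
    fun x x' h => hDK _ (hsA x) _ (by rw [hs, hs, h])
  have hjA : ∀ x, j x ∈ A₁ := fun x => by
    rw [hjdef, hD]
    exact hA₁inv _ _ (hA₁inv _ _ (hsA x))
  have hj : ∀ x : A, toOrbit α₁ (j x) = Δ.toFun (toOrbit α₀ x) := by
    intro x
    rw [← hs x, eq_comm, toOrbit_eq_iff]
    exact ⟨c₀ x * (c₁ (s x))⁻¹, by
      rw [hjdef, hD, ← Equiv.Perm.mul_apply, ← map_mul]; simp⟩
  have hjmk : ∀ (k : K) (x : A), j ⟨α₀ (1, k) x, hAinv _ _ x.2⟩ = α₁ (1, k) (j x) := by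
    intro k x
    have h1 : D (s ⟨α₀ (1, k) x, hAinv _ _ x.2⟩) = D (s x) :=
      hDs _ _ (toOrbit_eq_iff.2 ⟨k, rfl⟩).symm
    rw [hjdef, hjdef, h1, hc₀ x x.2, ← Equiv.Perm.mul_apply, ← map_mul]
    simp
  have hΔm : Measurable fun x : A => Δ.toFun (toOrbit α₀ (x : X₀)) :=
    Δ.measurable_toFun.comp (((measurable_toOrbit α₀).comp measurable_subtype_coe).subtype_mk
      (h := fun x : A => (hA1 x x.2).2.1))
  have hjm : Measurable j := by
    rw [funext hjdef]
    refine hα₁.measurable.comp ((measurable_const.prodMk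
      (hc₀m.comp measurable_subtype_coe)).prodMk fun B hB => ?_)
    -- `D ∘ s` factors through the orbit space, on which `D ⁻¹' B` descends to a measurable set
    have hSm : MeasurableSet (toOrbit α₁ '' (A₁ ∩ D ⁻¹' B)) :=
      measurableSet_toOrbit_image (hA₁m.inter (hDm hB)) fun k z hz => ⟨hA₁inv _ _ hz.1, by
        rw [Set.mem_preimage, ← hDK z hz.1 _ (toOrbit_eq_iff.2 ⟨k, rfl⟩)]
        exact hz.2⟩
    have : (fun x => D (s x)) ⁻¹' B =
        (fun x : A => Δ.toFun (toOrbit α₀ (x : X₀))) ⁻¹' (toOrbit α₁ '' (A₁ ∩ D ⁻¹' B)) := by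
      ext x
      constructor
      · exact fun hx => ⟨s x, ⟨hsA x, hx⟩, hs x⟩
      · rintro ⟨z, ⟨hzA, hz⟩, hzs⟩
        rw [Set.mem_preimage, ← hDK z hzA (s x) (by rw [hzs, hs])]
        exact hz
    rw [this]
    exact hΔm hSm
  have hjinj : Function.Injective j := by
    intro x x' h
    have h1 : toOrbit α₀ (x : X₀) = toOrbit α₀ (x' : X₀) := by
      have h2 : Δ.toFun (toOrbit α₀ (x : X₀)) = Δ.toFun (toOrbit α₀ (x' : X₀)) := by
        rw [← hj, ← hj, h]
      rw [← Δ.left_inv' (hA1 x x.2).2.1, h2, Δ.left_inv' (hA1 x' x'.2).2.1]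
    obtain ⟨k, hk⟩ := toOrbit_eq_iff.1 h1
    have h3 : x' = ⟨α₀ (1, k) x, hAinv _ _ x.2⟩ := Subtype.ext hk.symm
    have h4 : α₁ (1, k) (j x) = j x := by rw [← hjmk, ← h3, h]
    obtain rfl : k = 1 := congrArg Prod.snd (hA₁free _ (hjA x) _ h4)
    rw [← Prod.one_eq_mk, map_one] at hk
    exact Subtype.ext hk
  -- the orbits correspond
  have hsub₁ : ∀ (h : Λ₁ × K) (x : A), ∃ g, j ⟨α₀ g x, hAinv g _ x.2⟩ = α₁ h (j x) := by
    rintro ⟨l, k⟩ x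
    have h1 : quotientAction α₁ l (Δ.toFun (toOrbit α₀ x)) ∈
        Δ.toFun '' orbit (quotientAction α₀) (toOrbit α₀ (x : X₀)) := by
      rw [hQorb _ (hA1 x x.2).1]
      exact ⟨l, rfl⟩
    obtain ⟨_, ⟨l₀, rfl⟩, hl₀⟩ := h1
    have h2 : toOrbit α₁ (j ⟨α₀ (l₀, 1) x, hAinv _ _ x.2⟩) = toOrbit α₁ (α₁ (l, k) (j x)) := by
      rw [hj ⟨α₀ (l₀, 1) x, hAinv _ _ x.2⟩, toOrbit_smul α₁, hj x, ← hl₀]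
      rfl
    obtain ⟨k', hk'⟩ := toOrbit_eq_iff.1 h2
    refine ⟨(1, k') * (l₀, 1), ?_⟩
    rw [← hk', ← hjmk]
    simp only [map_mul, Equiv.Perm.mul_apply]
  have hsub₀ : ∀ (g : Λ₀ × K) (x : A), ∃ h, α₁ h (j x) = j ⟨α₀ g x, hAinv g _ x.2⟩ := by
    rintro ⟨l, k⟩ x
    have h1 : Δ.toFun (quotientAction α₀ l (toOrbit α₀ (x : X₀))) ∈
        orbit (quotientAction α₁) (Δ.toFun (toOrbit α₀ x)) := by
      rw [← hQorb _ (hA1 x x.2).1]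
      exact ⟨_, ⟨l, rfl⟩, rfl⟩
    obtain ⟨l₁, hl₁⟩ := h1
    have h2 : toOrbit α₁ (α₁ (l₁, 1) (j x)) = toOrbit α₁ (j ⟨α₀ (l, k) x, hAinv _ _ x.2⟩) := by
      rw [hj ⟨α₀ (l, k) x, hAinv _ _ x.2⟩, toOrbit_smul α₁, hj x, toOrbit_smul α₀, ← hl₁]
    obtain ⟨k', hk'⟩ := toOrbit_eq_iff.1 h2
    exact ⟨(1, k') * (l₁, 1), by rw [map_mul, Equiv.Perm.mul_apply, hk']⟩
  obtain ⟨β₁, hβ₁⟩ := exists_action_of_injective α₁ hjinj fun g x =>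
    (hsub₁ g x).imp' (fun g => ⟨α₀ g x, hAinv g _ x.2⟩) fun _ h => h
  -- the measures correspond
  have hval : MeasurePreserving Subtype.val (μ₀.comap (Subtype.val : A → X₀)) μ₀ := by
    refine ⟨measurable_subtype_coe, ?_⟩
    rw [map_comap_subtype_coe hAm]
    exact Measure.restrict_eq_self_of_ae_mem hAae
  set ν := μ₀.comap (Subtype.val : A → X₀) with hν
  have hνp : IsProbabilityMeasure ν := ⟨by
    rw [← Set.preimage_univ (f := (Subtype.val : A → X₀)),
      hval.measure_preimage MeasurableSet.univ.nullMeasurableSet, measure_univ]⟩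
  have hβ₀pmp : IsPMP (restrictAction α₀ A hAinv) ν :=
    hα₀.of_measurableEmbedding (MeasurableEmbedding.subtype_coe hAm) hval fun _ _ => rfl
  have hjmp : MeasurePreserving j ν μ₁ := by
    refine ⟨hjm, ?_⟩
    have : IsProbabilityMeasure (ν.map j) := Measure.isProbabilityMeasure_map hjm.aemeasurable
    refine measure_eq_of_eq_on_invariant (α₁.comp (MonoidHom.inr Λ₁ K)) hK₁ _ _ (fun k => ?_)
      (fun k => hα₁.measurePreserving (1, k)) fun S hS hSK => ?_
    · exact (MeasurePreserving.mk hjm rfl).of_semiconj (hβ₀pmp.measurePreserving (1, k))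
        (fun x => hjmk k x) (hα₁.measurePreserving (1, k)).measurable
    · have hTm := measurableSet_toOrbit_image hS hSK
      rw [Measure.map_apply hjm hS]
      have h1 : j ⁻¹' S = Subtype.val ⁻¹'
          (toOrbit α₀ ⁻¹' (Δ.source ∩ Δ.toFun ⁻¹' (toOrbit α₁ '' S))) := by
        ext x
        have h2 : j x ∈ S ↔ toOrbit α₁ (j x) ∈ toOrbit α₁ '' S := by
          conv_lhs => rw [← toOrbit_preimage_image hSK]
          rfl
        rw [Set.mem_preimage, h2, hj]
        exact ⟨fun h => ⟨(hA1 x x.2).2.1, h⟩, fun h => h.2⟩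
      have hm := Δ.measurableSet_inter_preimage hTm
      rw [h1, hval.measure_preimage (hq₀.measurable hm).nullMeasurableSet,
        hq₀.measure_preimage hm.nullMeasurableSet]
      refine (Δ.measure_preimage _ hTm).trans ?_
      rw [quotientMeasure_apply _ _ hTm, toOrbit_preimage_image hSK]
  refine ⟨A, ν, j, restrictAction α₀ A hAinv, β₁, hAm, hνp, hval, hjmp, hjinj, fun _ _ => rfl,
    hβ₁, ⟨fun g x hg => (hA x x.2).1 g (congrArg Subtype.val hg),
      fun g x hg => hA₁free _ (hjA x) g ((hβ₁ g x).symm.trans (congrArg j hg)),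
      fun k x => hjinj ((hjmk k x).trans (hβ₁ (1, k) x).symm), fun g x => ?_, fun h x => ?_⟩,
    fun x => ⟨(hA1 x x.2).1, hj x⟩⟩
  · obtain ⟨h, hh⟩ := hsub₀ g x
    exact ⟨h, hjinj ((hβ₁ h x).trans hh)⟩
  · obtain ⟨g, hg⟩ := hsub₁ h x
    exact ⟨g, hjinj (hg.trans (hβ₁ h x).symm)⟩

/-! ### Orbits and conjugacy under the map between the co-induced spaces -/

namespace SameOrbits

variable {Γ Λ₀ Λ₁ K X : Type*} [Group Γ] [Group Λ₀] [Group Λ₁] [Group K]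
  {α₀ : Λ₀ × K →* Equiv.Perm X} {α₁ : Λ₁ × K →* Equiv.Perm X} (M : SameOrbits α₀ α₁)
  (r₀ : EquivariantMap (freeFactor Γ Λ₀)) (r₁ : EquivariantMap (freeFactor Γ Λ₁))

theorem theta_compact (k : K) (y : RightCosets (freeFactor Γ Λ₀) → X) :
    M.theta r₀ r₁ (coinducedProdAction r₀ α₀ (1, k) y) =
      coinducedProdAction r₁ α₁ (1, k) (M.theta r₀ r₁ y) := by
  rw [theta_smul, rewire_compact]

theorem exists_theta_smul_eq (g : Monoid.Coprod Γ Λ₀ × K)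
    (y : RightCosets (freeFactor Γ Λ₀) → X) :
    ∃ g', M.theta r₀ r₁ (coinducedProdAction r₀ α₀ g y) =
      coinducedProdAction r₁ α₁ g' (M.theta r₀ r₁ y) := by
  rw [theta_smul]
  exact M.symm.exists_rewire_eq _ g _

theorem exists_smul_theta_eq (g : Monoid.Coprod Γ Λ₁ × K)
    (y : RightCosets (freeFactor Γ Λ₀) → X) :
    ∃ g', coinducedProdAction r₁ α₁ g (M.theta r₀ r₁ y) =
      M.theta r₀ r₁ (coinducedProdAction r₀ α₀ g' y) := by
  obtain ⟨g', hg'⟩ := M.exists_rewire_eq (equivariantAlong_root r₀ α₀) g y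
  exact ⟨g', by rw [← hg', theta_rewire]⟩

/-- If `Λ₀` and `Λ₁` move the points of the base alike up to `δ` and `K`, then `theta` intertwines
the co-induced actions up to `id * δ` and `K`. -/
theorem exists_theta_smul_eq_of_conj (δ : Λ₀ ≃* Λ₁)
    (hδ : ∀ l x, ∃ k, α₀ (l, 1) x = α₁ (δ l, k) x) (g : Monoid.Coprod Γ Λ₀) :
    ∀ y : RightCosets (freeFactor Γ Λ₀) → X,
      ∃ k, M.theta r₀ r₁ (coinducedProdAction r₀ α₀ (g, 1) y) =
        coinducedProdAction r₁ α₁ (MulEquiv.coprodCongr (MulEquiv.refl Γ) δ g, k)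
          (M.theta r₀ r₁ y) := by
  induction g using Monoid.Coprod.induction_on with
  | inl γ =>
    intro y
    refine ⟨1, ?_⟩
    rw [theta_smul, rewire_inl]
    simp [MulEquiv.coprodCongr]
  | inr l =>
    intro y
    obtain ⟨k, hk⟩ := hδ l (root _ (M.theta r₀ r₁ y))
    refine ⟨k, ?_⟩
    have h := M.symm.rewire_freeFactor (equivariantAlong_root r₁ α₁) l 1 (M.theta r₀ r₁ y)
    rw [M.symm.cocycle_eq hk.symm] at h
    rw [theta_smul]
    refine h.trans ?_
    simp [MulEquiv.coprodCongr, freeFactor]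
  | mul a b ha hb =>
    intro y
    obtain ⟨k, hk⟩ := hb y
    obtain ⟨l, hl⟩ := ha (coinducedProdAction r₀ α₀ (b, 1) y)
    refine ⟨l * k, ?_⟩
    have h1 : ((a * b, 1) : Monoid.Coprod Γ Λ₀ × K) = (a, 1) * (b, 1) := by simp
    rw [h1, map_mul, Equiv.Perm.mul_apply, hl, hk, ← Equiv.Perm.mul_apply, ← map_mul,
      Prod.mk_mul_mk, ← map_mul]

end SameOrbits

theorem measurePreserving_comp_infinitePi {I X X' : Type*} [MeasurableSpace X] [MeasurableSpace X']
    {μ : Measure X} {μ' : Measure X'} [IsProbabilityMeasure μ] [IsProbabilityMeasure μ']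
    {f : X → X'} (hf : MeasurePreserving f μ μ') :
    MeasurePreserving (fun y : I → X => f ∘ y) (Measure.infinitePi fun _ : I => μ)
      (Measure.infinitePi fun _ : I => μ') := by
  refine ⟨measurable_pi_iff.2 fun i => hf.measurable.comp (measurable_pi_apply i), ?_⟩
  have := Measure.infinitePi_map_pi (fun _ : I => μ) (f := fun _ => f) fun _ => hf.measurable
  simp only [hf.map_eq] at this
  exact this

/-- An identification of the spaces of `K`-orbits that matches the orbits of `Λ₀` and `Λ₁` yields
an identification `Δ'` of the spaces of `K`-orbits of the co-induced actions that matches the orbits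
of `Γ * Λ₀` and `Γ * Λ₁`, and also intertwines these actions along `id * δ` as soon as `Δ`
intertwines the given ones along `δ`. -/
theorem exists_coinduced_probIso {Γ Λ₀ Λ₁ K X₀ X₁ : Type*} [Group Γ] [Countable Γ]
    [Group Λ₀] [Countable Λ₀] [MeasurableSpace Λ₀] [DiscreteMeasurableSpace Λ₀]
    [Group Λ₁] [Countable Λ₁] [MeasurableSpace Λ₁] [DiscreteMeasurableSpace Λ₁]
    [Group K] [TopologicalSpace K] [IsTopologicalGroup K] [T2Space K] [CompactSpace K]
    [SecondCountableTopology K] [MeasurableSpace K] [BorelSpace K]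
    [MeasurableSpace X₀] [StandardBorelSpace X₀] {μ₀ : Measure X₀} [IsProbabilityMeasure μ₀]
    [MeasurableSpace X₁] [StandardBorelSpace X₁] {μ₁ : Measure X₁} [IsProbabilityMeasure μ₁]
    {α₀ : Λ₀ × K →* Equiv.Perm X₀} (hα₀ : IsPMP α₀ μ₀) (hfree₀ : IsEssentiallyFree α₀ μ₀)
    {α₁ : Λ₁ × K →* Equiv.Perm X₁} (hα₁ : IsPMP α₁ μ₁) (hfree₁ : IsEssentiallyFree α₁ μ₁)
    (r₀ : EquivariantMap (freeFactor Γ Λ₀)) (r₁ : EquivariantMap (freeFactor Γ Λ₁))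
    (Δ : ProbIso (quotientMeasure α₀ μ₀) (quotientMeasure α₁ μ₁)) {Q : OrbitSpace α₀ → Prop}
    (hQ : ∀ᵐ q ∂(quotientMeasure α₀ μ₀), Q q)
    (hQorb : ∀ q, Q q →
      Δ.toFun '' orbit (quotientAction α₀) q = orbit (quotientAction α₁) (Δ.toFun q)) :
    ∃ Δ' : ProbIso
      (quotientMeasure (coinducedProdAction r₀ α₀) (coinducedMeasure (freeFactor Γ Λ₀) μ₀))
      (quotientMeasure (coinducedProdAction r₁ α₁) (coinducedMeasure (freeFactor Γ Λ₁) μ₁)),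
      (∀ᵐ q ∂(quotientMeasure (coinducedProdAction r₀ α₀)
          (coinducedMeasure (freeFactor Γ Λ₀) μ₀)),
        Δ'.toFun '' orbit (quotientAction (coinducedProdAction r₀ α₀)) q =
          orbit (quotientAction (coinducedProdAction r₁ α₁)) (Δ'.toFun q)) ∧
      ∀ δ : Λ₀ ≃* Λ₁,
        (∀ q, Q q → ∀ l, Δ.toFun (quotientAction α₀ l q) = quotientAction α₁ (δ l) (Δ.toFun q)) →
        ∀ g, ∀ᵐ q ∂(quotientMeasure (coinducedProdAction r₀ α₀)
            (coinducedMeasure (freeFactor Γ Λ₀) μ₀)),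
          Δ'.toFun (quotientAction (coinducedProdAction r₀ α₀) g q) =
            quotientAction (coinducedProdAction r₁ α₁)
              (MulEquiv.coprodCongr (MulEquiv.refl Γ) δ g) (Δ'.toFun q) := by
  obtain ⟨A, ν, j, β₀, β₁, hA, hν, hval, hj, hjinj, hβ₀, hβ₁, M, hx⟩ :=
    exists_common_model hα₀ hfree₀ hα₁ hfree₁ Δ hQ hQorb
  have := hA.standardBorel
  have := countable_coprod (Γ := Γ) (Λ := Λ₀)
  have := countable_coprod (Γ := Γ) (Λ := Λ₁)
  have : Countable (RightCosets (freeFactor Γ Λ₀)) :=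
    (Quotient.mk_surjective (s := QuotientGroup.rightRel (freeFactor Γ Λ₀).range)).countable
  have : Countable (RightCosets (freeFactor Γ Λ₁)) :=
    (Quotient.mk_surjective (s := QuotientGroup.rightRel (freeFactor Γ Λ₁).range)).countable
  have hβ₀pmp : IsPMP β₀ ν :=
    hα₀.of_measurableEmbedding (MeasurableEmbedding.subtype_coe hA) hval hβ₀
  have hβ₁pmp : IsPMP β₁ ν :=
    hα₁.of_measurableEmbedding (hj.measurable.measurableEmbedding hjinj) hj hβ₁
  have hν' : IsProbabilityMeasure (coinducedMeasure (freeFactor Γ Λ₀) ν) := by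
    unfold coinducedMeasure; infer_instance
  -- the two equivariant models of `A ^ (Λ₀ \ (Γ * Λ₀))`
  have hJ₀ : MeasurePreserving (fun y : RightCosets (freeFactor Γ Λ₀) → A => Subtype.val ∘ y)
      (coinducedMeasure (freeFactor Γ Λ₀) ν) (coinducedMeasure (freeFactor Γ Λ₀) μ₀) :=
    measurePreserving_comp_infinitePi hval
  have hJ₁ : MeasurePreserving (fun y => j ∘ M.theta r₀ r₁ y)
      (coinducedMeasure (freeFactor Γ Λ₀) ν) (coinducedMeasure (freeFactor Γ Λ₁) μ₁) :=
    (measurePreserving_comp_infinitePi hj).comp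
      (M.measurePreserving_theta r₀ r₁ hβ₀pmp hβ₁pmp.measurePreserving)
  have hθinj : Function.Injective (M.theta r₀ r₁) :=
    Function.LeftInverse.injective (M.theta_symm_theta r₀ r₁)
  have eq₀ : ∀ g (y : RightCosets (freeFactor Γ Λ₀) → A),
      Subtype.val ∘ coinducedProdAction r₀ β₀ g y =
        coinducedProdAction r₀ α₀ g (Subtype.val ∘ y) :=
    coinducedProdAction_comp hβ₀
  have eq₁ : ∀ g (y : RightCosets (freeFactor Γ Λ₁) → A),
      j ∘ coinducedProdAction r₁ β₁ g y = coinducedProdAction r₁ α₁ g (j ∘ y) :=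
    coinducedProdAction_comp hβ₁
  obtain ⟨Δ', hΔ', hae⟩ := exists_probIso_quotient
    (A₀ := coinducedProdAction r₀ α₀) (A₁ := coinducedProdAction r₁ α₁)
    ((coinducedProdAction r₀ β₀).comp (MonoidHom.inr _ K)) hJ₀ hJ₁
    (Subtype.val_injective.comp_left) ((hjinj.comp_left).comp hθinj)
    (fun k y => eq₀ (1, k) y) (fun k y => by
      rw [MonoidHom.comp_apply, MonoidHom.inr_apply, M.theta_compact, eq₁])
  refine ⟨Δ', ?_, fun δ hδ g => ?_⟩
  · filter_upwards [hae]
    rintro _ ⟨y, rfl⟩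
    ext z
    constructor
    · rintro ⟨_, ⟨g, rfl⟩, rfl⟩
      obtain ⟨⟨a, k⟩, hak⟩ := M.exists_theta_smul_eq r₀ r₁ (g, 1) y
      refine ⟨a, ?_⟩
      simp only [quotientAction_toOrbit, ← eq₀, hΔ', hak]
      rw [eq₁, toOrbit_smul _ a k, quotientAction_toOrbit]
    · rintro ⟨a, rfl⟩
      obtain ⟨⟨g, k⟩, hgk⟩ := M.exists_smul_theta_eq r₀ r₁ (a, 1) y
      refine ⟨_, ⟨g, rfl⟩, ?_⟩
      simp only
      rw [← toOrbit_smul _ g k, ← eq₀, hΔ', hΔ', ← hgk, eq₁, quotientAction_toOrbit]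
  · have hβ : ∀ l x, ∃ k, β₀ (l, 1) x = β₁ (δ l, k) x := by
      intro l x
      have h1 : toOrbit α₁ (α₁ (δ l, 1) (j x)) = toOrbit α₁ (j (β₀ (l, 1) x)) := by
        rw [(hx _).2, toOrbit_smul, (hx x).2, ← hδ _ (hx x).1, hβ₀]
        rfl
      obtain ⟨k, hk⟩ := toOrbit_eq_iff.1 h1
      refine ⟨k, hjinj ?_⟩
      rw [← hk, hβ₁, ← Equiv.Perm.mul_apply, ← map_mul]
      simp
    filter_upwards [hae]
    rintro _ ⟨y, rfl⟩
    obtain ⟨k, hk⟩ := M.exists_theta_smul_eq_of_conj r₀ r₁ δ hβ g y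
    rw [quotientAction_toOrbit, ← eq₀, hΔ', hΔ', hk, eq₁, toOrbit_smul]

end CoInd

theorem mainTheorem3
    {Γ Λ₀ Λ₁ K X₀ X₁ : Type*}
    [Group Γ] [Countable Γ]
    [Group Λ₀] [Countable Λ₀] [MeasurableSpace Λ₀] [DiscreteMeasurableSpace Λ₀]
    [Group Λ₁] [Countable Λ₁] [MeasurableSpace Λ₁] [DiscreteMeasurableSpace Λ₁]
    [Group K] [TopologicalSpace K] [IsTopologicalGroup K] [T2Space K] [CompactSpace K]
    [SecondCountableTopology K] [MeasurableSpace K] [BorelSpace K]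
    [MeasurableSpace X₀] [StandardBorelSpace X₀] (μ₀ : Measure X₀) [IsProbabilityMeasure μ₀]
    [MeasurableSpace X₁] [StandardBorelSpace X₁] (μ₁ : Measure X₁) [IsProbabilityMeasure μ₁]
    (α₀ : Λ₀ × K →* Equiv.Perm X₀) (hα₀ : CoInd.IsPMP α₀ μ₀)
    (hfree₀ : CoInd.IsEssentiallyFree α₀ μ₀)
    (α₁ : Λ₁ × K →* Equiv.Perm X₁) (hα₁ : CoInd.IsPMP α₁ μ₁)
    (hfree₁ : CoInd.IsEssentiallyFree α₁ μ₁)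
    (r₀ : CoInd.EquivariantMap (CoInd.freeFactor Γ Λ₀))
    (r₁ : CoInd.EquivariantMap (CoInd.freeFactor Γ Λ₁)) :
    (CoInd.OrbitEquivalent
        (CoInd.quotientAction α₀) (CoInd.quotientMeasure α₀ μ₀)
        (CoInd.quotientAction α₁) (CoInd.quotientMeasure α₁ μ₁) →
      CoInd.OrbitEquivalent
        (CoInd.quotientAction (CoInd.coinducedProdAction r₀ α₀))
        (CoInd.quotientMeasure (CoInd.coinducedProdAction r₀ α₀)
          (CoInd.coinducedMeasure (CoInd.freeFactor Γ Λ₀) μ₀))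
        (CoInd.quotientAction (CoInd.coinducedProdAction r₁ α₁))
        (CoInd.quotientMeasure (CoInd.coinducedProdAction r₁ α₁)
          (CoInd.coinducedMeasure (CoInd.freeFactor Γ Λ₁) μ₁))) ∧
    (∀ δ : Λ₀ ≃* Λ₁,
      CoInd.ConjugateVia δ
        (CoInd.quotientAction α₀) (CoInd.quotientMeasure α₀ μ₀)
        (CoInd.quotientAction α₁) (CoInd.quotientMeasure α₁ μ₁) →
      CoInd.ConjugateVia (MulEquiv.coprodCongr (MulEquiv.refl Γ) δ)
        (CoInd.quotientAction (CoInd.coinducedProdAction r₀ α₀))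
        (CoInd.quotientMeasure (CoInd.coinducedProdAction r₀ α₀)
          (CoInd.coinducedMeasure (CoInd.freeFactor Γ Λ₀) μ₀))
        (CoInd.quotientAction (CoInd.coinducedProdAction r₁ α₁))
        (CoInd.quotientMeasure (CoInd.coinducedProdAction r₁ α₁)
          (CoInd.coinducedMeasure (CoInd.freeFactor Γ Λ₁) μ₁))) := by
  constructor
  · rintro ⟨Δ, hΔ⟩
    obtain ⟨Δ', hΔ', -⟩ := CoInd.exists_coinduced_probIso hα₀ hfree₀ hα₁ hfree₁ r₀ r₁ Δ hΔ
      fun _ h => h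
    exact ⟨Δ', hΔ'⟩
  · rintro δ ⟨Δ, hΔ⟩
    obtain ⟨Δ', -, hΔ'⟩ := CoInd.exists_coinduced_probIso hα₀ hfree₀ hα₁ hfree₁ r₀ r₁ Δ
      (MeasureTheory.ae_all_iff.2 hΔ) fun q hq => by
        ext z
        constructor
        · rintro ⟨_, ⟨l, rfl⟩, rfl⟩
          exact ⟨δ l, (hq l).symm⟩
        · rintro ⟨l, rfl⟩
          exact ⟨_, ⟨δ.symm l, rfl⟩, by simp only [hq, MulEquiv.apply_symm_apply]⟩
    exact ⟨Δ', hΔ' δ fun _ h => h⟩
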